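/- **Theorem (gradient descent follows the frozen-kernel spectral formula).** *Model.* Let $x_1,\dots,x_n\in\mathbb R^d$ be the (encoded) inputs and $y\in\mathbb R^n$ the labels. For a width $m$, first-layer weights $W=(w_1,\dots,w_m)$, $w_r\in\mathbb R^d$, and coefficients $c\in\mathbb R^m$ consider the normalized Hadamard network $$f(W,c;x)=\frac1{\sqrt m}\sum_{r=1}^m c_r\frac{\sigma(w_r^\top x)}{\sqrt{S(x)}},\qquad S(x)=\sum_{r=1}^m\sigma(w_r^\top x)^2,\qquad \sigma(t)=\max(t,0)$$ (with value $0$ if $S(x)=0$). Put $u_i=f(W,c;x_i)$ and $\Phi(W)=\frac12\|y-u\|_2^2$. Gradients are taken with $\sigma'(t)=\mathbb 1\{t\ge 0\}$. Gradient descent with step size $\eta$ is $w_r(k+1)=w_r(k)-\eta\,\partial\Phi/\partial w_r(W(k))$ with $c$ fixed, and $u(k)$ is the prediction vector at step $k$. The kernel $H(W)\in\mathbb R^{n\times n}$ is either of the following two (the theorem holds for each): the neural tangent kernel $H_{ij}=\sum_r\langle\partial u_i/\partial w_r,\partial u_j/\partial w_r\rangle$, or the closed form $$H_{ij}=\frac{x_i^\top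 x_j}{m}\sum_{r=1}^m c_r^2\,\frac{\mathbb I_{r,i}\beta_{r,i}}{\sqrt{S(x_i)}}\,\frac{\mathbb I_{r,j}\beta_{r,j}}{\sqrt{S(x_j)}},\qquad \mathbb I_{r,i}=\mathbb 1\{w_r^\top x_i\ge0\},\quad \beta_{r,i}=1-\frac{\sigma(w_r^\top x_i)^2}{S(x_i)} .$$ *Assumptions.* Fix $a,\kappa,\lambda_0>0$ and $R_x,C,P\in\mathbb R$. * **A1.** $\|x_i\|_2\le R_x$ and $|y_i|\le C$ for all $i$. * **A2.** At width $m$, $c_r=a_rp_r$ with fixed modulation coefficients $p_r=p_r^{(m)}$ satisfying $|p_r^{(m)}|\le P\sqrt m$; the $w_r(0)\sim\mathcal N(0,\kappa^2I_d)$ and $a_r\sim\mathrm{Unif}\{\pm a\}$ are all independent. * **A3.** As $m\to\infty$, $H(W(0))$ converges in probability to a matrix $H^\infty$ with $\lambda_{\min}(H^\infty)=\lambda_0>0$. *Conclusion.* Let $T=T(m)$ be polynomially bounded in $m$ and let $\delta>0$. There are constants $K$ and $m_0$, depending only on $n,R_x,C,\kappa,a,P,\lambda_0,\delta,T$, such that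 for every $m\ge m_0$, with probability at least $1-\delta$ over the initialization, the following holds. If $\|H(W(0))-H^\infty\|_2\le\lambda_0/2$, then for every step size $0<\eta\le\|H(W(0))\|_2^{-1}$ and every decomposition $H(W(0))=\sum_{i=1}^n\lambda_iv_iv_i^\top$ with an orthonormal basis $v_1,\dots,v_n$ of $\mathbb R^n$, one has for all $k\ge0$ $$\|u(k)-y\|_2=\sqrt{\sum_{i=1}^n(1-\eta\lambda_i)^{2k}\bigl(v_i^\top(u(0)-y)\bigr)^2}+\epsilon(k),\qquad\text{where}\qquad \sup_{0\le k\le T(m)}|\epsilon(k)|\le\frac{K}{\sqrt m}.$$ -/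

import Mathlib

open MeasureTheory ProbabilityTheory Filter Topology
open scoped RealInnerProductSpace

noncomputable section

namespace HadamardNet

/-! ### The two-layer normalized Hadamard model -/

/-- The ReLU activation. -/
def relu (t : ℝ) : ℝ := max t 0

/-- The ReLU gate `𝟙{t ≥ 0}`. -/
def gate (t : ℝ) : ℝ := if 0 ≤ t then 1 else 0

variable {d m n : ℕ}

/-- The hidden energy `S(x) = ∑ r, σ(w_r ⬝ x)²`. -/
def energy (W : Fin m → EuclideanSpace ℝ (Fin d)) (x : EuclideanSpace ℝ (Fin d)) : ℝ :=
  ∑ r, relu ⟪W r, x⟫ ^ 2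

/-- The network output `f(W, c; x) = m^{-1/2} ∑ r, c_r σ(w_r ⬝ x) / √S(x)`. -/
def output (c : Fin m → ℝ) (W : Fin m → EuclideanSpace ℝ (Fin d))
    (x : EuclideanSpace ℝ (Fin d)) : ℝ :=
  (1 / √(m : ℝ)) * ∑ r, c r * (relu ⟪W r, x⟫ / √(energy W x))

/-- The vector of predictions `u = (f(W, c; x_1), …, f(W, c; x_n))`. -/
def predictions (x : Fin n → EuclideanSpace ℝ (Fin d)) (c : Fin m → ℝ)
    (W : Fin m → EuclideanSpace ℝ (Fin d)) : EuclideanSpace ℝ (Fin n) :=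
  WithLp.toLp 2 fun i => output c W (x i)

/-- The quadratic loss `Φ(W) = ½ ‖y - u‖²`. -/
def loss (x : Fin n → EuclideanSpace ℝ (Fin d)) (y : EuclideanSpace ℝ (Fin n)) (c : Fin m → ℝ)
    (W : Fin m → EuclideanSpace ℝ (Fin d)) : ℝ :=
  (1 / 2) * ‖y - predictions x c W‖ ^ 2

/-! ### Gradients, with the convention `σ'(t) = 𝟙{t ≥ 0}` -/

/-- The gradient `∂f/∂w_r` of the network output.  When `w_r ⬝ x ≠ 0` and `S(x) > 0` it is the
gradient in the sense of calculus, see `hasGradientAt_output`; at a kink of the activation, `σ'` is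
the gate. -/
def outputGrad (c : Fin m → ℝ) (W : Fin m → EuclideanSpace ℝ (Fin d))
    (x : EuclideanSpace ℝ (Fin d)) (r : Fin m) : EuclideanSpace ℝ (Fin d) :=
  ((1 / √(m : ℝ)) * gate ⟪W r, x⟫ *
    (c r / √(energy W x) -
      relu ⟪W r, x⟫ * (∑ l, c l * relu ⟪W l, x⟫) / (energy W x * √(energy W x)))) • x

/-- The gradient `∂Φ/∂w_r = ∑ i, (u_i - y_i) ∂u_i/∂w_r` of the loss. -/
def lossGrad (x : Fin n → EuclideanSpace ℝ (Fin d)) (y : EuclideanSpace ℝ (Fin n))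
    (c : Fin m → ℝ) (W : Fin m → EuclideanSpace ℝ (Fin d)) (r : Fin m) :
    EuclideanSpace ℝ (Fin d) :=
  ∑ i, (predictions x c W i - y i) • outputGrad c W (x i) r

/-- Gradient descent on the first-layer weights with step size `η`, started at `W₀`. -/
def gdWeights (x : Fin n → EuclideanSpace ℝ (Fin d)) (y : EuclideanSpace ℝ (Fin n))
    (c : Fin m → ℝ) (η : ℝ) (W₀ : Fin m → EuclideanSpace ℝ (Fin d)) :
    ℕ → Fin m → EuclideanSpace ℝ (Fin d)
  | 0 => W₀
  | k + 1 => fun r => gdWeights x y c η W₀ k r - η • lossGrad x y c (gdWeights x y c η W₀ k) r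

/-! ### The neural tangent kernel -/

/-- The NTK matrix: the Gram matrix `H_ij = ∑ r, ⟪∂u_i/∂w_r, ∂u_j/∂w_r⟫` of the gradients. -/
def ntk (x : Fin n → EuclideanSpace ℝ (Fin d)) (c : Fin m → ℝ)
    (W : Fin m → EuclideanSpace ℝ (Fin d)) : Matrix (Fin n) (Fin n) ℝ :=
  Matrix.of fun i j => ∑ r, ⟪outputGrad c W (x i) r, outputGrad c W (x j) r⟫

/-- The normalization correction `β_r = 1 - σ(w_r ⬝ x)² / S(x)`. -/
def normCorr (W : Fin m → EuclideanSpace ℝ (Fin d)) (x : EuclideanSpace ℝ (Fin d))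
    (r : Fin m) : ℝ :=
  1 - relu ⟪W r, x⟫ ^ 2 / energy W x

/-- The closed form of the NTK
`H_ij = (x_i ⬝ x_j / m) ∑ r, c_r² (𝟙_{r,i} β_{r,i} / √S_i) (𝟙_{r,j} β_{r,j} / √S_j)`,
in which the influence of `w_r` on the summands `ℓ ≠ r` of the output, through the common factor
`S`, is neglected. -/
def ntkClosed (x : Fin n → EuclideanSpace ℝ (Fin d)) (c : Fin m → ℝ)
    (W : Fin m → EuclideanSpace ℝ (Fin d)) : Matrix (Fin n) (Fin n) ℝ :=
  Matrix.of fun i j => (⟪x i, x j⟫ / m) *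
    ∑ r, c r ^ 2 * (gate ⟪W r, x i⟫ * normCorr W (x i) r / √(energy W (x i))) *
      (gate ⟪W r, x j⟫ * normCorr W (x j) r / √(energy W (x j)))

/-- The spectral norm of a square real matrix. -/
def specNorm (A : Matrix (Fin n) (Fin n) ℝ) : ℝ := ‖Matrix.toEuclideanCLM (𝕜 := ℝ) A‖

/-! ### Random initialization -/

/-- The uniform law on `{a, -a}`. -/
def signLaw (a : ℝ) : Measure ℝ := (2⁻¹ : ENNReal) • (Measure.dirac a + Measure.dirac (-a))

/-- The law of the initialization `(W(0), (a_r))` at width `m`: the `w_r(0) ∼ N(0, κ² I_d)` and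
the `a_r ∼ Unif{±a}`, `r < m`, are all independent. -/
def initLaw (d : ℕ) (κ a : ℝ) (m : ℕ) :
    Measure ((Fin m → EuclideanSpace ℝ (Fin d)) × (Fin m → ℝ)) :=
  (Measure.pi fun _ : Fin m =>
      multivariateGaussian (0 : EuclideanSpace ℝ (Fin d)) (κ ^ 2 • (1 : Matrix _ _ ℝ))).prod
    (Measure.pi fun _ : Fin m => signLaw a)

/-- The coefficients `c_r = a_r p_r` (Hadamard product). -/
def coeffs (s p : Fin m → ℝ) : Fin m → ℝ := fun r => s r * p r

/-- `Hinf` is the infinite-width limit of the random kernels `H(W(0))`: the width-`m` kernels at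
initialization, with modulation coefficients `p m`, converge to `Hinf` in probability. -/
def IsInfiniteWidthNTK
    (H : ∀ m : ℕ, (Fin m → ℝ) → (Fin m → EuclideanSpace ℝ (Fin d)) → Matrix (Fin n) (Fin n) ℝ)
    (κ a : ℝ) (p : ∀ m : ℕ, Fin m → ℝ) (Hinf : Matrix (Fin n) (Fin n) ℝ) : Prop :=
  ∀ ε : ℝ, 0 < ε →
    Tendsto (fun m => initLaw d κ a m {ω | ε ≤ specNorm (H m (coeffs ω.2 (p m)) ω.1 - Hinf)})
      atTop (𝓝 0)

/-! ### The gradients are gradients -/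

lemma hasDerivAt_relu {t : ℝ} (ht : t ≠ 0) : HasDerivAt relu (gate t) t := by
  rcases lt_or_gt_of_ne ht with h | h
  · have : relu =ᶠ[𝓝 t] fun _ => (0 : ℝ) := by
      filter_upwards [Iio_mem_nhds h] with s hs
      exact max_eq_right (le_of_lt hs)
    simpa [gate, not_le.mpr h] using (hasDerivAt_const t (0 : ℝ)).congr_of_eventuallyEq this
  · have : relu =ᶠ[𝓝 t] fun s => s := by
      filter_upwards [Ioi_mem_nhds h] with s hs
      exact max_eq_left (le_of_lt hs)
    simpa [gate, h.le] using (hasDerivAt_id' t).congr_of_eventuallyEq this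

theorem hasGradientAt_output (c : Fin m → ℝ) (W : Fin m → EuclideanSpace ℝ (Fin d))
    (x : EuclideanSpace ℝ (Fin d)) (r : Fin m) (hr : ⟪W r, x⟫ ≠ 0) (hS : 0 < energy W x) :
    HasGradientAt (fun v => output c (Function.update W r v) x) (outputGrad c W x r) (W r) := by
  set A : ℝ := ∑ l ∈ Finset.univ.erase r, c l * relu ⟪W l, x⟫ with hA
  set B : ℝ := ∑ l ∈ Finset.univ.erase r, relu ⟪W l, x⟫ ^ 2 with hB
  set t : ℝ := ⟪W r, x⟫ with ht
  have hE : ∀ v, energy (Function.update W r v) x = B + relu ⟪v, x⟫ ^ 2 := by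
    intro v
    rw [energy, ← Finset.sum_erase_add _ _ (Finset.mem_univ r), hB]
    congr 1
    · refine Finset.sum_congr rfl fun l hl => ?_
      rw [Function.update_of_ne (Finset.ne_of_mem_erase hl)]
    · simp
  have hN : ∀ v, ∑ l, c l * relu ⟪Function.update W r v l, x⟫ = A + c r * relu ⟪v, x⟫ := by
    intro v
    rw [← Finset.sum_erase_add _ _ (Finset.mem_univ r), hA]
    congr 1
    · refine Finset.sum_congr rfl fun l hl => ?_
      rw [Function.update_of_ne (Finset.ne_of_mem_erase hl)]
    · simp
  have hE0 : energy W x = B + relu t ^ 2 := by simpa using hE (W r)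
  have hN0 : ∑ l, c l * relu ⟪W l, x⟫ = A + c r * relu t := by simpa using hN (W r)
  have hout : (fun v => output c (Function.update W r v) x) =
      (fun s => (1 / √(m : ℝ)) * ((A + c r * relu s) / √(B + relu s ^ 2))) ∘
        fun v => ⟪v, x⟫ := by
    funext v
    simp only [output, hE, Function.comp, ← hN, Finset.sum_div, mul_div_assoc]
  rw [hE0] at hS
  have hsq : √(B + relu t ^ 2) ≠ 0 := (Real.sqrt_pos.mpr hS).ne'
  have h1 := hasDerivAt_relu hr
  have h2 := (((h1.const_mul (c r)).const_add A).div
    (((h1.pow 2).const_add B).sqrt hS.ne') hsq).const_mul (1 / √(m : ℝ))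
  rw [hasGradientAt_iff_hasFDerivAt, hout]
  have h3 : HasFDerivAt (fun v : EuclideanSpace ℝ (Fin d) => ⟪v, x⟫) (innerSL ℝ x) (W r) := by
    have := (innerSL ℝ x).hasFDerivAt (x := W r)
    refine this.congr_of_eventuallyEq (Eventually.of_forall fun v => ?_)
    simp [real_inner_comm]
  refine (HasDerivAt.comp_hasFDerivAt (W r) h2 h3).congr_fderiv ?_
  ext v
  simp only [outputGrad, hE0, hN0, ← ht]
  have hS2 : √(B + relu t ^ 2) ^ 2 = B + relu t ^ 2 := Real.sq_sqrt hS.le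
  have key : (1 / √(m : ℝ)) * ((c r * gate t * √(B + relu t ^ 2) - (A + c r * relu t) *
        ((2 : ℕ) * relu t ^ (2 - 1) * gate t / (2 * √(B + relu t ^ 2)))) / √(B + relu t ^ 2) ^ 2)
      = (1 / √(m : ℝ)) * gate t * (c r / √(B + relu t ^ 2) -
        relu t * (A + c r * relu t) / ((B + relu t ^ 2) * √(B + relu t ^ 2))) := by
    generalize √(B + relu t ^ 2) = q at hsq hS2
    rw [← hS2]
    field_simp
    push_cast
    ring
  simp only [InnerProductSpace.toDual_apply_apply, real_inner_smul_left, ← key]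
  simp

theorem hasGradientAt_loss (x : Fin n → EuclideanSpace ℝ (Fin d)) (y : EuclideanSpace ℝ (Fin n))
    (c : Fin m → ℝ) (W : Fin m → EuclideanSpace ℝ (Fin d)) (r : Fin m)
    (hr : ∀ i, ⟪W r, x i⟫ ≠ 0) (hS : ∀ i, 0 < energy W (x i)) :
    HasGradientAt (fun v => loss x y c (Function.update W r v)) (lossGrad x y c W r) (W r) := by
  rw [hasGradientAt_iff_hasFDerivAt]
  have h : ∀ i, HasFDerivAt (fun v => (1 / 2) * (y i - output c (Function.update W r v) (x i)) ^ 2)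
      (InnerProductSpace.toDual ℝ _ ((predictions x c W i - y i) • outputGrad c W (x i) r))
      (W r) := by
    intro i
    have h1 := (hasGradientAt_iff_hasFDerivAt.mp
      (hasGradientAt_output c W (x i) r (hr i) (hS i))).const_sub (y i)
    refine ((h1.pow 2).const_mul (1 / 2)).congr_fderiv ?_
    ext v
    simp [predictions]
    ring
  have h2 := HasFDerivAt.fun_sum (u := Finset.univ) fun i _ => h i
  rw [lossGrad, map_sum]
  refine h2.congr_of_eventuallyEq (Eventually.of_forall fun v => ?_)
  simp [loss, EuclideanSpace.norm_sq_eq, predictions, Finset.mul_sum]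

end HadamardNet

end

open HadamardNet

/-!
The network is trained in the lazy regime.  With `e_i` the normalized inputs, let
`φ_{i,r} = m^{-1/2} c_r 𝟙{w_r(0) ⬝ e_i ≥ 0} / √S(e_i)` be the derivative of `u_i` in the direction
`e_i` of `w_r` at initialization, with the normalization held fixed (`leadCoef`).  Every entry is
`O(1/√m)`, because `|c_r| = O(√m)` and `√S` is of order `√m`.

Suppose that the weights have moved by at most `ρ/√m` each.  Then `√S` has moved by `O(1)`, being
the Euclidean norm of the hidden layer, and only the `O(√m)` gates whose preactivation was within
`ρ/√m` of zero can have flipped.  Hence the features of the gradient are still within `O(1)` of `φ`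
in `ℓ¹` (`RegularInit.sum_abs_outCoef_sub_le`), and the output is affine with slope `φ` up to an
error of the order of the largest weight increment (`RegularInit.abs_output_sub_sub_le`).  Pairing
the `ℓ¹` bound with the `ℓ∞` bound `O(1/√m)` shows that both kernels at initialization, and the
mixed kernel that governs a step of gradient descent, agree with the Gram matrix of `φ` up to
`O(1/√m)`.  So the residual `z = u - y` satisfies `z(k+1) = (1 - η H) z(k) + O(η ‖z(k)‖ / √m)` with
`H = H(W(0))` (`RegularInit.norm_step_sub_le`).

The limit `H^∞` is symmetric, so `H`, at distance at most `λ₀/2` from it, has least eigenvalue at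
least `λ₀/2`.  As also `η H ≤ 1`, the residual contracts geometrically, the total movement of a
weight is a geometric series of size `O(1/√m)`, which closes the bootstrap, and the accumulated
deviation from `(1 - η H)^k z(0)` is a geometric series as well (`RegularInit.gd_tracks_linear`).
The bound `K/√m` is thus uniform over all `k`.  Expanding `(1 - η H)^k z(0)` in the eigenbasis
gives the spectral formula.

What is required of the initialization is elementary: `S` is of order `m` by Chebyshev's
inequality for the number of neurons with preactivation at least `κ`; the outputs are `O(1)` since
they are combinations of random signs; and the number of preactivations within `ρ/√m` of zero is
`O(√m)` by Markov's inequality (`initLaw_not_regular_le`).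
-/

open HadamardNet

/-! ### Independent sums and counts -/

lemma pi_abs_sum_sub_ge_le {m : ℕ} {α : Type*} [MeasurableSpace α] (μ : Measure α)
    [IsProbabilityMeasure μ] (X : Fin m → α → ℝ) (hX : ∀ r, MemLp (X r) 2 μ) {c : ℝ}
    (hc : 0 < c) :
    Measure.pi (fun _ : Fin m => μ) {ω | c ≤ |∑ r, X r (ω r) - ∑ r, ∫ z, X r z ∂μ|} ≤
      ENNReal.ofReal ((∑ r, variance (X r) μ) / c ^ 2) := by
  have hX' : ∀ r, MemLp (fun ω : Fin m → α => X r (ω r)) 2 (Measure.pi fun _ : Fin m => μ) :=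
    fun r => (hX r).comp_measurePreserving (measurePreserving_eval _ r)
  have h := meas_ge_le_variance_div_sq (memLp_finsetSum' Finset.univ fun r _ => hX' r) hc
  rw [variance_sum_pi hX] at h
  have hint : (∫ ω, (∑ r, fun ω : Fin m → α => X r (ω r)) ω ∂Measure.pi fun _ : Fin m => μ) =
      ∑ r, ∫ z, X r z ∂μ := by
    simp only [Finset.sum_apply]
    rw [integral_finsetSum _ fun r _ => (hX' r).integrable one_le_two]
    refine Finset.sum_congr rfl fun r _ => ?_
    exact integral_comp_eval (μ := fun _ : Fin m => μ) (hX r).1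
  rw [hint] at h
  simpa only [Finset.sum_apply] using h

/-- Chebyshev's inequality for the number of coordinates that fall in `s`: it is unlikely to be at
most half its mean. -/
lemma pi_card_le_half_le {m : ℕ} {α : Type*} [MeasurableSpace α] (μ : Measure α)
    [IsProbabilityMeasure μ] {s : Set α} [DecidablePred (· ∈ s)] (hs : MeasurableSet s)
    (hm : 0 < m) (hq : 0 < μ.real s) :
    Measure.pi (fun _ : Fin m => μ)
        {ω | ((Finset.univ.filter fun r => ω r ∈ s).card : ℝ) ≤ m * μ.real s / 2} ≤
      ENNReal.ofReal (4 / (m * μ.real s ^ 2)) := by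
  have hm' : (0 : ℝ) < m := by exact_mod_cast hm
  have hmem : MemLp (s.indicator fun _ => (1 : ℝ)) 2 μ := (memLp_const 1).indicator hs
  have h := pi_abs_sum_sub_ge_le (m := m) μ (fun _ => s.indicator fun _ => (1 : ℝ))
    (fun _ => hmem) (c := m * μ.real s / 2) (by positivity)
  refine (measure_mono fun ω hω => ?_).trans (h.trans (ENNReal.ofReal_le_ofReal ?_))
  · simp only [Set.mem_ofPred_eq, Set.indicator_apply, Finset.sum_boole] at hω ⊢
    rw [abs_sub_comm]
    refine le_trans ?_ (le_abs_self _)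
    have : (∫ z, (if z ∈ s then (1 : ℝ) else 0) ∂μ) = μ.real s := by
      have := integral_indicator_one (μ := μ) hs
      simpa [Set.indicator_apply] using this
    simp only [this, Finset.sum_const, Finset.card_univ, Fintype.card_fin, nsmul_eq_mul]
    linarith
  · have hv : variance (s.indicator fun _ => (1 : ℝ)) μ ≤ 1 := by
      -- Popoviciu's bound on an interval of length `2` already gives `1`
      have h0 := variance_le_sq_of_bounded (a := 0) (b := 2) (μ := μ)
        (X := s.indicator fun _ => (1 : ℝ))
        (ae_of_all _ fun z => by
          by_cases hz : z ∈ s <;> simp [hz])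
        hmem.1.aemeasurable
      norm_num at h0
      exact h0
    simp only [Finset.sum_const, Finset.card_univ, Fintype.card_fin, nsmul_eq_mul]
    rw [div_le_div_iff₀ (by positivity) (by positivity)]
    calc m * variance (s.indicator fun _ => (1 : ℝ)) μ * (m * μ.real s ^ 2)
        ≤ m * 1 * (m * μ.real s ^ 2) := by gcongr
      _ = 4 * (m * μ.real s / 2) ^ 2 := by ring

/-- Markov's inequality for the number of coordinates that fall in `s`. -/
lemma pi_card_ge_le {m : ℕ} {α : Type*} [MeasurableSpace α] (μ : Measure α)
    [IsProbabilityMeasure μ] {s : Set α} [DecidablePred (· ∈ s)] (hs : MeasurableSet s)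
    {c : ℝ} (hc : 0 < c) :
    Measure.pi (fun _ : Fin m => μ)
        {ω | c ≤ ((Finset.univ.filter fun r => ω r ∈ s).card : ℝ)} ≤
      ENNReal.ofReal (m * μ.real s / c) := by
  have hind : Measurable fun z => s.indicator (1 : α → ENNReal) z := measurable_one.indicator hs
  have hr : ∀ r : Fin m, Measurable fun ω : Fin m → α => s.indicator (1 : α → ENNReal) (ω r) :=
    fun r => hind.comp (measurable_pi_apply r)
  have hlin : (∫⁻ ω, ∑ r : Fin m, s.indicator (1 : α → ENNReal) (ω r)
      ∂Measure.pi fun _ : Fin m => μ) = ENNReal.ofReal (m * μ.real s) := by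
    rw [lintegral_finsetSum _ fun r _ => hr r]
    have : ∀ r : Fin m, (∫⁻ ω, s.indicator (1 : α → ENNReal) (ω r)
        ∂Measure.pi fun _ : Fin m => μ) = μ s := by
      intro r
      rw [(measurePreserving_eval (fun _ : Fin m => μ) r).lintegral_comp hind,
        lintegral_indicator_one hs]
    simp [this, ENNReal.ofReal_mul]
  rw [ENNReal.ofReal_div_of_pos hc, ← hlin]
  refine le_trans (measure_mono fun ω hω => ?_) (meas_ge_le_lintegral_div
    (Finset.measurable_sum _ fun r _ => hr r).aemeasurable (by simpa using hc)
    ENNReal.ofReal_ne_top)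
  have hsum : ∑ r : Fin m, s.indicator (1 : α → ENNReal) (ω r) =
      ((Finset.univ.filter fun r => ω r ∈ s).card : ENNReal) := by
    simp only [Set.indicator_apply, Pi.one_apply, Finset.sum_boole]
  simp only [Set.mem_ofPred_eq] at hω ⊢
  rw [hsum]
  exact ENNReal.ofReal_le_of_le_toReal (by simpa using hω)

/-! ### The law of the initialization -/

instance isProbabilityMeasure_signLaw (a : ℝ) : IsProbabilityMeasure (signLaw a) := by
  constructor
  simp only [signLaw, Measure.smul_apply, Measure.add_apply, measure_univ, smul_eq_mul]
  rw [one_add_one_eq_two]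
  exact ENNReal.inv_mul_cancel (by norm_num) (by norm_num)

lemma integral_signLaw (a : ℝ) (f : ℝ → ℝ) :
    ∫ s, f s ∂signLaw a = (f a + f (-a)) / 2 := by
  rw [signLaw, integral_smul_measure, integral_add_measure (integrable_dirac (by simp))
    (integrable_dirac (by simp)), integral_dirac, integral_dirac]
  simp
  ring

lemma ae_signLaw (a : ℝ) : ∀ᵐ s ∂signLaw a, |s| = |a| := by
  refine Measure.ae_smul_measure (ae_add_measure_iff.2 ⟨?_, ?_⟩) _ <;>
    simp [ae_dirac_eq]

lemma memLp_id_signLaw (a : ℝ) : MemLp (fun s : ℝ => s) 2 (signLaw a) :=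
  MemLp.of_bound (by fun_prop) |a| ((ae_signLaw a).mono fun s hs => by simp [hs])

/-- A random-sign combination `∑ r, s_r b_r` is of the order of `‖b‖₂`. -/
lemma pi_signLaw_abs_sum_ge_le {m : ℕ} (a : ℝ) (b : Fin m → ℝ) {c : ℝ} (hc : 0 < c) :
    Measure.pi (fun _ : Fin m => signLaw a) {s | c ≤ |∑ r, s r * b r|} ≤
      ENNReal.ofReal (a ^ 2 * (∑ r, b r ^ 2) / c ^ 2) := by
  have h := pi_abs_sum_sub_ge_le (signLaw a) (fun r s => s * b r)
    (fun r => (memLp_id_signLaw a).mul_const (b r)) hc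
  have h0 : ∀ r, ∫ z, z * b r ∂signLaw a = 0 := fun r => by
    rw [integral_signLaw]; ring
  have hv : ∀ r, variance (fun s => s * b r) (signLaw a) = a ^ 2 * b r ^ 2 := fun r => by
    rw [variance_eq_sub ((memLp_id_signLaw a).mul_const (b r)), h0]
    simp only [Pi.pow_apply]
    rw [integral_signLaw]
    ring
  simpa only [h0, hv, Finset.sum_const_zero, sub_zero, ← Finset.mul_sum] using h

lemma map_inner_multivariateGaussian {d : ℕ} (κ : ℝ) (e : EuclideanSpace ℝ (Fin d))
    (he : ‖e‖ = 1) :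
    (multivariateGaussian (0 : EuclideanSpace ℝ (Fin d)) (κ ^ 2 • (1 : Matrix _ _ ℝ))).map
      (fun w => ⟪w, e⟫) = gaussianReal 0 (κ ^ 2).toNNReal := by
  have hS : (κ ^ 2 • (1 : Matrix (Fin d) (Fin d) ℝ)).PosSemidef :=
    Matrix.PosSemidef.one.smul (sq_nonneg κ)
  have hL : (fun w : EuclideanSpace ℝ (Fin d) => ⟪w, e⟫) = innerSL ℝ e := by
    ext w; simp [real_inner_comm]
  rw [hL, IsGaussian.map_eq_gaussianReal, ContinuousLinearMap.integral_comp_id_comm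
    IsGaussian.integrable_id]
  congr 2
  · simp
  · have h := covarianceBilin_self (μ := multivariateGaussian (0 : EuclideanSpace ℝ (Fin d))
      (κ ^ 2 • (1 : Matrix _ _ ℝ))) IsGaussian.memLp_two_id e
    rw [covarianceBilin_multivariateGaussian hS] at h
    change variance (fun u => ⟪e, u⟫) _ = _
    rw [← h]
    have he2 : e.ofLp ⬝ᵥ e.ofLp = 1 := by
      have := EuclideanSpace.real_norm_sq_eq e
      rw [he] at this
      simpa [dotProduct, sq] using this.symm
    simp [Matrix.smul_mulVec, he2]

/-- Small-ball estimate: the Gaussian density is at most `1 / (2 κ)`. -/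
lemma gaussianReal_abs_le {κ : ℝ} (hκ : 0 < κ) {t : ℝ} (ht : 0 ≤ t) :
    (gaussianReal 0 (κ ^ 2).toNNReal).real {z | |z| ≤ t} ≤ t / κ := by
  have hv : (κ ^ 2).toNNReal ≠ 0 := by simpa using hκ.ne'
  have hset : {z : ℝ | |z| ≤ t} = Set.Icc (-t) t := by ext; simp [abs_le]
  rw [hset, measureReal_def, gaussianReal_apply_eq_integral _ hv,
    ENNReal.toReal_ofReal (integral_nonneg fun z => gaussianPDFReal_nonneg _ _ _)]
  have hb : ∀ z, gaussianPDFReal 0 (κ ^ 2).toNNReal z ≤ 1 / (2 * κ) := by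
    intro z
    rw [gaussianPDFReal, Real.coe_toNNReal _ (sq_nonneg κ)]
    have h1 : 2 * κ ≤ √(2 * Real.pi * κ ^ 2) := by
      apply Real.le_sqrt_of_sq_le
      nlinarith [Real.pi_gt_three, sq_pos_of_pos hκ]
    have h2 : Real.exp (-(z - 0) ^ 2 / (2 * κ ^ 2)) ≤ 1 :=
      Real.exp_le_one_iff.2 (div_nonpos_of_nonpos_of_nonneg (by nlinarith [sq_nonneg (z - 0)])
        (by positivity))
    calc (√(2 * Real.pi * κ ^ 2))⁻¹ * Real.exp (-(z - 0) ^ 2 / (2 * κ ^ 2))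
        ≤ (√(2 * Real.pi * κ ^ 2))⁻¹ * 1 := by gcongr
      _ ≤ (2 * κ)⁻¹ * 1 := by gcongr
      _ = 1 / (2 * κ) := by ring
  calc ∫ z in Set.Icc (-t) t, gaussianPDFReal 0 (κ ^ 2).toNNReal z
      ≤ ∫ _ in Set.Icc (-t) t, 1 / (2 * κ) :=
        integral_mono (integrable_gaussianPDFReal _ _).integrableOn
          (integrable_const _) hb
    _ = t / κ := by
        simp only [integral_const, measureReal_restrict_apply_univ, Real.volume_real_Icc,
          smul_eq_mul]
        rw [max_eq_left (by linarith)]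
        field_simp
        ring

lemma gaussianReal_Ici_pos {κ : ℝ} (hκ : 0 < κ) :
    0 < (gaussianReal 0 (κ ^ 2).toNNReal).real (Set.Ici κ) := by
  have hv : (κ ^ 2).toNNReal ≠ 0 := by simpa using hκ.ne'
  refine ENNReal.toReal_pos (fun h => ?_) (measure_ne_top _ _)
  have := gaussianReal_absolutelyContinuous' 0 hv h
  simp at this

/-! ### Bounds at initialization -/

lemma relu_nonneg (t : ℝ) : 0 ≤ relu t := le_max_right _ _

lemma energy_nonneg {d m : ℕ} (W : Fin m → EuclideanSpace ℝ (Fin d))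
    (x : EuclideanSpace ℝ (Fin d)) : 0 ≤ energy W x :=
  Finset.sum_nonneg fun _ _ => sq_nonneg _

instance isProbabilityMeasure_initLaw (d : ℕ) (κ a : ℝ) (m : ℕ) :
    IsProbabilityMeasure (initLaw d κ a m) := by
  unfold initLaw; infer_instance

lemma initLaw_fst_le {d m : ℕ} (κ a : ℝ) (s : Set (Fin m → EuclideanSpace ℝ (Fin d))) :
    initLaw d κ a m {ω | ω.1 ∈ s} ≤
      Measure.pi (fun _ : Fin m => multivariateGaussian (0 : EuclideanSpace ℝ (Fin d))
        (κ ^ 2 • (1 : Matrix _ _ ℝ))) s := by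
  have : {ω : (Fin m → EuclideanSpace ℝ (Fin d)) × (Fin m → ℝ) | ω.1 ∈ s} = s ×ˢ Set.univ := by
    ext; simp
  rw [this, initLaw, Measure.prod_prod, measure_univ, mul_one]

/-- The signs of the second layer have modulus `a` almost surely. -/
lemma initLaw_abs_snd_ne (d : ℕ) (κ a : ℝ) (m : ℕ) :
    initLaw d κ a m {ω | ¬ ∀ r, |ω.2 r| = |a|} = 0 := by
  have h : ∀ᵐ s ∂Measure.pi (fun _ : Fin m => signLaw a), ∀ r, |s r| = |a| :=
    ae_all_iff.2 fun r =>
      (measurePreserving_eval (fun _ : Fin m => signLaw a) r).quasiMeasurePreserving.ae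
        (ae_signLaw a)
  exact (Measure.quasiMeasurePreserving_snd (μ := Measure.pi fun _ : Fin m =>
    multivariateGaussian (0 : EuclideanSpace ℝ (Fin d)) (κ ^ 2 • (1 : Matrix _ _ ℝ)))).ae h

lemma multivariateGaussian_inner_mem {d : ℕ} (κ : ℝ) {e : EuclideanSpace ℝ (Fin d)}
    (he : ‖e‖ = 1) {s : Set ℝ} (hs : MeasurableSet s) :
    (multivariateGaussian (0 : EuclideanSpace ℝ (Fin d)) (κ ^ 2 • (1 : Matrix _ _ ℝ))).real
      {w | ⟪w, e⟫ ∈ s} = (gaussianReal 0 (κ ^ 2).toNNReal).real s := by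
  rw [← map_inner_multivariateGaussian κ e he, measureReal_def, measureReal_def,
    Measure.map_apply (by fun_prop) hs]
  rfl

/-- The energy at initialization is of order `m`: a positive fraction of the neurons has
preactivation at least `κ`. -/
lemma initLaw_energy_le {d m : ℕ} {κ : ℝ} (hκ : 0 < κ) (a : ℝ) (hm : 0 < m)
    {e : EuclideanSpace ℝ (Fin d)} (he : ‖e‖ = 1) :
    initLaw d κ a m {ω | energy ω.1 e ≤
        κ ^ 2 * ((gaussianReal 0 (κ ^ 2).toNNReal).real (Set.Ici κ) / 2) * m} ≤
      ENNReal.ofReal (4 / (m * (gaussianReal 0 (κ ^ 2).toNNReal).real (Set.Ici κ) ^ 2)) := by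
  classical
  set q := (gaussianReal 0 (κ ^ 2).toNNReal).real (Set.Ici κ) with hq
  have hqe := multivariateGaussian_inner_mem κ he (measurableSet_Ici (a := κ))
  have hmeas : MeasurableSet {w : EuclideanSpace ℝ (Fin d) | ⟪w, e⟫ ∈ Set.Ici κ} :=
    measurableSet_preimage (by fun_prop : Measurable fun w : EuclideanSpace ℝ (Fin d) => ⟪w, e⟫)
      measurableSet_Ici
  have h := pi_card_le_half_le (m := m) _ hmeas hm (by rw [hqe]; exact gaussianReal_Ici_pos hκ)
  rw [hqe] at h
  refine le_trans ?_ ((initLaw_fst_le κ a _).trans h)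
  refine measure_mono fun ω hω => ?_
  simp only [Set.mem_ofPred_eq] at hω ⊢
  have hle : κ ^ 2 * ((Finset.univ.filter fun r => ⟪ω.1 r, e⟫ ∈ Set.Ici κ).card : ℝ) ≤
      energy ω.1 e := by
    calc κ ^ 2 * ((Finset.univ.filter fun r => ⟪ω.1 r, e⟫ ∈ Set.Ici κ).card : ℝ)
        = ∑ r ∈ Finset.univ.filter (fun r => ⟪ω.1 r, e⟫ ∈ Set.Ici κ), κ ^ 2 := by
          simp [mul_comm]
      _ ≤ ∑ r ∈ Finset.univ.filter (fun r => ⟪ω.1 r, e⟫ ∈ Set.Ici κ), relu ⟪ω.1 r, e⟫ ^ 2 := by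
          refine Finset.sum_le_sum fun r hr => ?_
          have : κ ≤ ⟪ω.1 r, e⟫ := (Finset.mem_filter.1 hr).2
          exact pow_le_pow_left₀ hκ.le (this.trans (le_max_left _ _)) 2
      _ ≤ energy ω.1 e :=
          Finset.sum_le_sum_of_subset_of_nonneg (Finset.filter_subset _ _)
            fun _ _ _ => sq_nonneg _
  have := hle.trans hω
  have hk : 0 < κ ^ 2 := by positivity
  refine le_of_mul_le_mul_left (this.trans (le_of_eq ?_)) hk
  ring

/-- Few neurons are within `t` of the kink of the activation at the input `e`. -/
lemma initLaw_card_inner_le {d m : ℕ} {κ : ℝ} (hκ : 0 < κ) (a : ℝ)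
    {e : EuclideanSpace ℝ (Fin d)} (he : ‖e‖ = 1) {t c : ℝ} (ht : 0 ≤ t) (hc : 0 < c) :
    initLaw d κ a m {ω | c ≤ ((Finset.univ.filter fun r => |⟪ω.1 r, e⟫| ≤ t).card : ℝ)} ≤
      ENNReal.ofReal (m * (t / κ) / c) := by
  classical
  have hms : MeasurableSet {z : ℝ | |z| ≤ t} := measurableSet_le (by fun_prop) (by fun_prop)
  have hqe := multivariateGaussian_inner_mem κ he hms
  have hmeas : MeasurableSet {w : EuclideanSpace ℝ (Fin d) | ⟪w, e⟫ ∈ {z : ℝ | |z| ≤ t}} :=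
    measurableSet_preimage (by fun_prop : Measurable fun w : EuclideanSpace ℝ (Fin d) => ⟪w, e⟫)
      hms
  have h := pi_card_ge_le (m := m) (multivariateGaussian (0 : EuclideanSpace ℝ (Fin d))
    (κ ^ 2 • (1 : Matrix _ _ ℝ))) hmeas hc
  rw [hqe] at h
  have hg := gaussianReal_abs_le hκ ht
  refine le_trans ?_ (((initLaw_fst_le κ a _).trans h).trans
    (ENNReal.ofReal_le_ofReal (by gcongr)))
  refine measure_mono fun ω hω => ?_
  simp only [Set.mem_ofPred_eq] at hω ⊢
  convert hω

lemma sum_sq_relu_div_sqrt_energy_le {d m : ℕ} (W : Fin m → EuclideanSpace ℝ (Fin d))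
    (x : EuclideanSpace ℝ (Fin d)) : ∑ r, (relu ⟪W r, x⟫ / √(energy W x)) ^ 2 ≤ 1 := by
  simp only [div_pow, Real.sq_sqrt (energy_nonneg W x), ← Finset.sum_div]
  exact div_self_le_one (energy W x)

lemma measurable_relu : Measurable relu := measurable_id.max measurable_const

/-- The output at initialization is of order one: conditionally on the first layer it is a
combination of random signs with coefficient vector of norm at most `P`. -/
lemma initLaw_abs_output_ge_le {d m : ℕ} (κ a P : ℝ) (p : Fin m → ℝ)
    (hp : ∀ r, |p r| ≤ P * √(m : ℝ)) (x : EuclideanSpace ℝ (Fin d)) {c : ℝ} (hc : 0 < c) :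
    initLaw d κ a m {ω | c ≤ |output (coeffs ω.2 p) ω.1 x|} ≤
      ENNReal.ofReal (a ^ 2 * P ^ 2 / c ^ 2) := by
  have hE : Measurable fun ω : (Fin m → EuclideanSpace ℝ (Fin d)) × (Fin m → ℝ) =>
      energy ω.1 x := by
    unfold energy
    refine Finset.measurable_sum _ fun r _ => (measurable_relu.comp ?_).pow_const 2
    fun_prop
  have hout : Measurable fun ω : (Fin m → EuclideanSpace ℝ (Fin d)) × (Fin m → ℝ) =>
      output (coeffs ω.2 p) ω.1 x := by
    unfold output coeffs
    refine (Finset.measurable_sum _ fun r _ => ?_).const_mul _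
    refine Measurable.mul (by fun_prop) ((measurable_relu.comp ?_).div hE.sqrt)
    fun_prop
  have hset : MeasurableSet {ω : (Fin m → EuclideanSpace ℝ (Fin d)) × (Fin m → ℝ) |
      c ≤ |output (coeffs ω.2 p) ω.1 x|} := measurableSet_le measurable_const hout.abs
  rw [initLaw, Measure.prod_apply hset]
  refine (lintegral_mono (g := fun _ => ENNReal.ofReal (a ^ 2 * P ^ 2 / c ^ 2))
    fun W => ?_).trans (by simp)
  set b : Fin m → ℝ := fun r => (1 / √(m : ℝ)) * (p r * (relu ⟪W r, x⟫ / √(energy W x))) with hb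
  have hsum : ∑ r, b r ^ 2 ≤ P ^ 2 := by
    have hbr : ∀ r, b r ^ 2 ≤ P ^ 2 * (relu ⟪W r, x⟫ / √(energy W x)) ^ 2 := by
      intro r
      have hm : (0 : ℝ) < m := by exact_mod_cast Fin.pos r
      have h1 : (p r) ^ 2 ≤ P ^ 2 * m := by
        have := pow_le_pow_left₀ (abs_nonneg _) (hp r) 2
        rwa [sq_abs, mul_pow, Real.sq_sqrt hm.le] at this
      calc b r ^ 2 = (p r ^ 2 / m) * (relu ⟪W r, x⟫ / √(energy W x)) ^ 2 := by
            rw [hb]; simp only [mul_pow, div_pow, Real.sq_sqrt hm.le]; ring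
        _ ≤ P ^ 2 * (relu ⟪W r, x⟫ / √(energy W x)) ^ 2 := by
            gcongr
            rwa [div_le_iff₀ hm]
    calc ∑ r, b r ^ 2 ≤ ∑ r, P ^ 2 * (relu ⟪W r, x⟫ / √(energy W x)) ^ 2 :=
          Finset.sum_le_sum fun r _ => hbr r
      _ ≤ P ^ 2 * 1 := by
          rw [← Finset.mul_sum]
          gcongr
          exact sum_sq_relu_div_sqrt_energy_le W x
      _ = P ^ 2 := mul_one _
  refine le_trans (le_of_eq ?_) ((pi_signLaw_abs_sum_ge_le a b hc).trans
    (ENNReal.ofReal_le_ofReal (by gcongr)))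
  congr 1
  ext s
  simp only [Set.mem_preimage, Set.mem_ofPred_eq, output, coeffs, hb, Finset.mul_sum]
  refine iff_of_eq (congrArg (fun z => c ≤ |z|) (Finset.sum_congr rfl fun r _ => ?_))
  ring

/-! ### The network near its initialization -/

lemma abs_relu_sub_relu_le (s t : ℝ) : |relu s - relu t| ≤ |s - t| :=
  abs_max_sub_max_le_abs s t 0

/-- Linearizing the ReLU with either of the two slopes `0` and `1` costs at most the increment. -/
lemma abs_relu_sub_relu_sub_gate_mul_le (s t z : ℝ) :
    |relu s - relu t - gate z * (s - t)| ≤ |s - t| := by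
  unfold gate
  split_ifs with hz
  · have h : ∀ u, relu u - u = relu (-u) := fun u => by
      rcases le_total 0 u with hu | hu <;> simp [relu, hu]
    have e : relu s - relu t - 1 * (s - t) = relu (-s) - relu (-t) := by
      rw [← h, ← h]; ring
    rw [e]
    refine (abs_relu_sub_relu_le _ _).trans (le_of_eq ?_)
    rw [← abs_neg]
    ring_nf
  · simpa using abs_relu_sub_relu_le s t

lemma abs_gate_le_one (t : ℝ) : |gate t| ≤ 1 := by
  unfold gate; split_ifs <;> simp

lemma abs_gate_sub_gate_le_one (s t : ℝ) : |gate s - gate t| ≤ 1 := by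
  unfold gate; split_ifs <;> simp

section Network

variable {d m n : ℕ}

/-- The scalar `g` with `∂f/∂w_r = g • x`. -/
noncomputable def outCoef (c : Fin m → ℝ) (W : Fin m → EuclideanSpace ℝ (Fin d))
    (x : EuclideanSpace ℝ (Fin d)) (r : Fin m) : ℝ :=
  (1 / √(m : ℝ)) * gate ⟪W r, x⟫ *
    (c r / √(energy W x) -
      relu ⟪W r, x⟫ * (∑ l, c l * relu ⟪W l, x⟫) / (energy W x * √(energy W x)))

/-- The scalars `g` for which the closed form of the kernel is the Gram matrix of the features
`g • x`. -/
noncomputable def closedCoef (c : Fin m → ℝ) (W : Fin m → EuclideanSpace ℝ (Fin d))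
    (x : EuclideanSpace ℝ (Fin d)) (r : Fin m) : ℝ :=
  (1 / √(m : ℝ)) * (c r * (gate ⟪W r, x⟫ * normCorr W x r / √(energy W x)))

/-- The leading part of `outCoef`: the coefficient of `x` in the derivative of the output with the
normalization `√S` held fixed. -/
noncomputable def leadCoef (c : Fin m → ℝ) (W : Fin m → EuclideanSpace ℝ (Fin d))
    (x : EuclideanSpace ℝ (Fin d)) (r : Fin m) : ℝ :=
  (1 / √(m : ℝ)) * (c r * (gate ⟪W r, x⟫ / √(energy W x)))

lemma outputGrad_eq_outCoef_smul (c : Fin m → ℝ) (W : Fin m → EuclideanSpace ℝ (Fin d))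
    (x : EuclideanSpace ℝ (Fin d)) (r : Fin m) :
    outputGrad c W x r = outCoef c W x r • x := rfl

lemma ntk_apply_eq (x : Fin n → EuclideanSpace ℝ (Fin d)) (c : Fin m → ℝ)
    (W : Fin m → EuclideanSpace ℝ (Fin d)) (i j : Fin n) :
    ntk x c W i j = ⟪x i, x j⟫ * ∑ r, outCoef c W (x i) r * outCoef c W (x j) r := by
  simp only [ntk, Matrix.of_apply, outputGrad_eq_outCoef_smul, real_inner_smul_left,
    real_inner_smul_right, Finset.mul_sum]
  exact Finset.sum_congr rfl fun r _ => by ring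

lemma ntkClosed_apply_eq (x : Fin n → EuclideanSpace ℝ (Fin d)) (c : Fin m → ℝ)
    (W : Fin m → EuclideanSpace ℝ (Fin d)) (i j : Fin n) :
    ntkClosed x c W i j = ⟪x i, x j⟫ * ∑ r, closedCoef c W (x i) r * closedCoef c W (x j) r := by
  simp only [ntkClosed, Matrix.of_apply, div_mul_eq_mul_div, mul_div_assoc, Finset.sum_div]
  congr 1
  refine Finset.sum_congr rfl fun r _ => ?_
  have hm : (0 : ℝ) < m := by exact_mod_cast Fin.pos r
  have h : (1 / √(m : ℝ)) * (1 / √(m : ℝ)) = 1 / m := by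
    rw [div_mul_div_comm, Real.mul_self_sqrt hm.le, one_mul]
  simp only [closedCoef]
  calc _ = c r ^ 2 * (gate ⟪W r, x i⟫ * (normCorr W (x i) r / √(energy W (x i)))) *
        (gate ⟪W r, x j⟫ * (normCorr W (x j) r / √(energy W (x j)))) * (1 / m) := by ring
    _ = _ := by rw [← h]; ring

lemma output_eq (c : Fin m → ℝ) (W : Fin m → EuclideanSpace ℝ (Fin d))
    (x : EuclideanSpace ℝ (Fin d)) :
    output c W x = (1 / √(m : ℝ)) * ((∑ l, c l * relu ⟪W l, x⟫) / √(energy W x)) := by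
  simp only [output, Finset.sum_div, mul_div_assoc]

/-- The correction to the leading coefficient comes from the dependence of `√S` on `w_r`. -/
lemma outCoef_eq (c : Fin m → ℝ) (W : Fin m → EuclideanSpace ℝ (Fin d))
    (x : EuclideanSpace ℝ (Fin d)) (r : Fin m) :
    outCoef c W x r = leadCoef c W x r -
      gate ⟪W r, x⟫ * (relu ⟪W r, x⟫ * output c W x / √(energy W x) ^ 2) := by
  rw [Real.sq_sqrt (energy_nonneg W x), outCoef, leadCoef, output_eq, ← div_div]
  ring

lemma normCorr_mem_Icc (W : Fin m → EuclideanSpace ℝ (Fin d))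
    (x : EuclideanSpace ℝ (Fin d)) (r : Fin m) : normCorr W x r ∈ Set.Icc (0 : ℝ) 1 := by
  have h1 : relu ⟪W r, x⟫ ^ 2 ≤ energy W x :=
    Finset.single_le_sum (f := fun r => relu ⟪W r, x⟫ ^ 2) (fun _ _ => sq_nonneg _)
      (Finset.mem_univ r)
  have h2 : relu ⟪W r, x⟫ ^ 2 / energy W x ≤ 1 := div_le_one_of_le₀ h1 (energy_nonneg W x)
  have h3 : 0 ≤ relu ⟪W r, x⟫ ^ 2 / energy W x := div_nonneg (sq_nonneg _) (energy_nonneg W x)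
  constructor <;> rw [normCorr] <;> linarith

lemma closedCoef_eq (c : Fin m → ℝ) (W : Fin m → EuclideanSpace ℝ (Fin d))
    (x : EuclideanSpace ℝ (Fin d)) (r : Fin m) :
    closedCoef c W x r = leadCoef c W x r * normCorr W x r := by
  rw [closedCoef, leadCoef]; ring

lemma sqrt_energy_eq_norm (W : Fin m → EuclideanSpace ℝ (Fin d))
    (x : EuclideanSpace ℝ (Fin d)) :
    √(energy W x) = ‖(WithLp.toLp 2 fun r => relu ⟪W r, x⟫ : EuclideanSpace ℝ (Fin m))‖ := by
  rw [EuclideanSpace.norm_eq]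
  simp [energy]

lemma abs_inner_sub_inner_le {W W' e : EuclideanSpace ℝ (Fin d)} (he : ‖e‖ = 1) {τ : ℝ}
    (h : ‖W' - W‖ ≤ τ) : |⟪W', e⟫ - ⟪W, e⟫| ≤ τ := by
  rw [← inner_sub_left]
  refine (abs_real_inner_le_norm _ _).trans ?_
  rwa [he, mul_one]

/-- `√S` is the Euclidean norm of the hidden layer, and the hidden layer is Lipschitz in the
weights. -/
lemma abs_sqrt_energy_sub_le {W W' : Fin m → EuclideanSpace ℝ (Fin d)}
    {e : EuclideanSpace ℝ (Fin d)} (he : ‖e‖ = 1) {τ : ℝ} (h : ∀ r, ‖W' r - W r‖ ≤ τ)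
    (hτ : 0 ≤ τ) : |√(energy W' e) - √(energy W e)| ≤ √(m : ℝ) * τ := by
  rw [sqrt_energy_eq_norm, sqrt_energy_eq_norm]
  refine (abs_norm_sub_norm_le _ _).trans ?_
  rw [EuclideanSpace.norm_eq]
  refine Real.sqrt_le_iff.2 ⟨by positivity, ?_⟩
  rw [mul_pow, Real.sq_sqrt (Nat.cast_nonneg m)]
  calc _ ≤ ∑ _r : Fin m, τ ^ 2 := by
        refine Finset.sum_le_sum fun r _ => ?_
        refine pow_le_pow_left₀ (norm_nonneg _) ?_ 2
        exact (abs_relu_sub_relu_le _ _).trans (abs_inner_sub_inner_le he (h r))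
    _ = m * τ ^ 2 := by simp

lemma relu_le_sqrt_energy (W : Fin m → EuclideanSpace ℝ (Fin d))
    (x : EuclideanSpace ℝ (Fin d)) (r : Fin m) : relu ⟪W r, x⟫ ≤ √(energy W x) :=
  Real.le_sqrt_of_sq_le
    (Finset.single_le_sum (f := fun r => relu ⟪W r, x⟫ ^ 2) (fun _ _ => sq_nonneg _)
      (Finset.mem_univ r))

lemma sum_relu_le (W : Fin m → EuclideanSpace ℝ (Fin d)) (x : EuclideanSpace ℝ (Fin d)) :
    ∑ r, relu ⟪W r, x⟫ ≤ √(m : ℝ) * √(energy W x) := by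
  rw [← Real.sqrt_mul (Nat.cast_nonneg m)]
  refine Real.le_sqrt_of_sq_le ?_
  have := sq_sum_le_card_mul_sum_sq (s := Finset.univ) (f := fun r => relu ⟪W r, x⟫)
  simpa [energy] using this

/-- The properties of the initialization `W₀` at a unit input `e` from which the lazy-training
estimates follow: the coefficients are at most `A √m`, the energy is at least `(2θ)² m`, and at
most `L √m` neurons are within the radius `ρ / √m` of the kink of the activation.  The last field
makes `m` large enough for the energy to stay of order `m` on the ball of that radius. -/
structure RegularInit (A θ L ρ : ℝ) (c : Fin m → ℝ) (W₀ : Fin m → EuclideanSpace ℝ (Fin d))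
    (e : EuclideanSpace ℝ (Fin d)) : Prop where
  m_pos : 0 < m
  A_nonneg : 0 ≤ A
  θ_pos : 0 < θ
  ρ_nonneg : 0 ≤ ρ
  norm_eq_one : ‖e‖ = 1
  abs_coeff_le : ∀ r, |c r| ≤ A * √(m : ℝ)
  le_sqrt_energy : 2 * θ * √(m : ℝ) ≤ √(energy W₀ e)
  card_le : ((Finset.univ.filter fun r => |⟪W₀ r, e⟫| ≤ ρ / √(m : ℝ)).card : ℝ) ≤ L * √(m : ℝ)
  ρ_le : ρ ≤ θ * √(m : ℝ)

namespace RegularInit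

variable {A θ L ρ M τ : ℝ} {c : Fin m → ℝ} {W₀ W W' : Fin m → EuclideanSpace ℝ (Fin d)}
  {e : EuclideanSpace ℝ (Fin d)}

lemma sqrt_pos (h : RegularInit A θ L ρ c W₀ e) : 0 < √(m : ℝ) :=
  Real.sqrt_pos.2 (by exact_mod_cast h.m_pos)

lemma sqrt_mul_sqrt (h : RegularInit A θ L ρ c W₀ e) : √(m : ℝ) * √(m : ℝ) = m :=
  Real.mul_self_sqrt (by exact_mod_cast h.m_pos.le)

lemma abs_sqrt_energy_sub_le (h : RegularInit A θ L ρ c W₀ e)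
    (hW : ∀ r, ‖W r - W₀ r‖ ≤ ρ / √(m : ℝ)) : |√(energy W e) - √(energy W₀ e)| ≤ ρ := by
  have := _root_.abs_sqrt_energy_sub_le h.norm_eq_one hW (div_nonneg h.ρ_nonneg h.sqrt_pos.le)
  rwa [mul_div_cancel₀ _ h.sqrt_pos.ne'] at this

lemma le_sqrt_energy_of_ball (h : RegularInit A θ L ρ c W₀ e)
    (hW : ∀ r, ‖W r - W₀ r‖ ≤ ρ / √(m : ℝ)) : θ * √(m : ℝ) ≤ √(energy W e) := by
  have h1 := (abs_le.1 (h.abs_sqrt_energy_sub_le hW)).1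
  have h2 := h.le_sqrt_energy
  have h3 := h.ρ_le
  linarith

lemma sqrt_energy_pos (h : RegularInit A θ L ρ c W₀ e)
    (hW : ∀ r, ‖W r - W₀ r‖ ≤ ρ / √(m : ℝ)) : 0 < √(energy W e) :=
  (mul_pos h.θ_pos h.sqrt_pos).trans_le (h.le_sqrt_energy_of_ball hW)

lemma self_mem_ball (h : RegularInit A θ L ρ c W₀ e) (r : Fin m) :
    ‖W₀ r - W₀ r‖ ≤ ρ / √(m : ℝ) := by
  simpa using div_nonneg h.ρ_nonneg h.sqrt_pos.le

lemma abs_coeff_div_le (h : RegularInit A θ L ρ c W₀ e) (r : Fin m) :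
    (1 / √(m : ℝ)) * |c r| ≤ A := by
  rw [one_div, inv_mul_le_iff₀ h.sqrt_pos, mul_comm]
  exact h.abs_coeff_le r

lemma abs_leadCoef_le (h : RegularInit A θ L ρ c W₀ e)
    (hW : ∀ r, ‖W r - W₀ r‖ ≤ ρ / √(m : ℝ)) (r : Fin m) :
    |leadCoef c W e r| ≤ A / θ / √(m : ℝ) := by
  have hq := h.le_sqrt_energy_of_ball hW
  have hq0 := h.sqrt_energy_pos hW
  have hA := h.A_nonneg
  have hθ := h.θ_pos
  have hs := h.sqrt_pos
  rw [leadCoef, abs_mul, abs_mul, abs_div (gate _), abs_of_pos hq0,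
    abs_of_pos (by positivity : 0 < 1 / √(m : ℝ)), ← mul_assoc, div_div]
  calc (1 / √(m : ℝ)) * |c r| * (|gate ⟪W r, e⟫| / √(energy W e))
      ≤ A * (1 / (θ * √(m : ℝ))) := by
        gcongr
        · exact h.abs_coeff_div_le r
        · exact abs_gate_le_one _
    _ = A / (θ * √(m : ℝ)) := by ring

lemma abs_outCoef_le (h : RegularInit A θ L ρ c W₀ e)
    (hW : ∀ r, ‖W r - W₀ r‖ ≤ ρ / √(m : ℝ)) (hM : |output c W e| ≤ M) (r : Fin m) :
    |outCoef c W e r| ≤ (A + M) / θ / √(m : ℝ) := by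
  have hq := h.le_sqrt_energy_of_ball hW
  have hq0 := h.sqrt_energy_pos hW
  have hθ := h.θ_pos
  have hs := h.sqrt_pos
  have hM0 := (abs_nonneg _).trans hM
  have h2 : |gate ⟪W r, e⟫ * (relu ⟪W r, e⟫ * output c W e / √(energy W e) ^ 2)| ≤
      M / θ / √(m : ℝ) := by
    rw [abs_mul, abs_div, abs_mul, abs_of_nonneg (relu_nonneg _),
      abs_of_pos (pow_pos hq0 2)]
    calc |gate ⟪W r, e⟫| * (relu ⟪W r, e⟫ * |output c W e| / √(energy W e) ^ 2)
        ≤ 1 * (√(energy W e) * M / √(energy W e) ^ 2) := by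
          gcongr
          · exact div_nonneg (mul_nonneg (relu_nonneg _) (abs_nonneg _)) (by positivity)
          · exact abs_gate_le_one _
          · exact relu_le_sqrt_energy W e r
      _ = M / √(energy W e) := by field_simp
      _ ≤ M / (θ * √(m : ℝ)) := by gcongr
      _ = M / θ / √(m : ℝ) := by rw [div_div]
  rw [outCoef_eq]
  refine (abs_sub _ _).trans ((add_le_add (h.abs_leadCoef_le hW r) h2).trans (le_of_eq ?_))
  ring

/-- On the ball only the gates of neurons near the kink can flip. -/
lemma inner_nonneg_iff_of_ball (h : RegularInit A θ L ρ c W₀ e)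
    (hW : ∀ r, ‖W r - W₀ r‖ ≤ ρ / √(m : ℝ)) {r : Fin m} (hr : ¬ |⟪W₀ r, e⟫| ≤ ρ / √(m : ℝ)) :
    (0 ≤ ⟪W r, e⟫ ↔ 0 ≤ ⟪W₀ r, e⟫) := by
  have h1 := abs_le.1 (abs_inner_sub_inner_le h.norm_eq_one (hW r))
  rcases lt_abs.1 (not_le.1 hr) with h2 | h2
  · exact iff_of_true (by linarith) (by
      linarith [div_nonneg h.ρ_nonneg h.sqrt_pos.le])
  · exact iff_of_false (by linarith) (by
      linarith [div_nonneg h.ρ_nonneg h.sqrt_pos.le])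

/-- A quantity that is at most `b` per neuron and is carried by the neurons near the kink sums to
`O(√m) b`. -/
lemma sum_abs_le_of_support (h : RegularInit A θ L ρ c W₀ e) {f : Fin m → ℝ} {b : ℝ}
    (hb : ∀ r, |f r| ≤ b) (hb0 : 0 ≤ b) (hf : ∀ r, ¬ |⟪W₀ r, e⟫| ≤ ρ / √(m : ℝ) → f r = 0) :
    ∑ r, |f r| ≤ L * √(m : ℝ) * b := by
  rw [← Finset.sum_filter_of_ne (p := fun r => |⟪W₀ r, e⟫| ≤ ρ / √(m : ℝ)) fun r _ hr => by
    by_contra hc; exact hr (by rw [hf r hc, abs_zero])]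
  calc _ ≤ ((Finset.univ.filter fun r => |⟪W₀ r, e⟫| ≤ ρ / √(m : ℝ)).card : ℝ) * b := by
        rw [← nsmul_eq_mul]
        exact Finset.sum_le_card_nsmul _ _ _ fun r _ => hb r
    _ ≤ L * √(m : ℝ) * b := by gcongr; exact h.card_le

lemma abs_inv_sqrt_energy_sub_le (h : RegularInit A θ L ρ c W₀ e)
    (hW : ∀ r, ‖W r - W₀ r‖ ≤ ρ / √(m : ℝ)) :
    |1 / √(energy W e) - 1 / √(energy W₀ e)| ≤ ρ / θ ^ 2 / m := by
  have hq := h.le_sqrt_energy_of_ball hW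
  have hq' := h.le_sqrt_energy_of_ball h.self_mem_ball
  have hq0 := h.sqrt_energy_pos hW
  have hq0' := h.sqrt_energy_pos h.self_mem_ball
  have hθ := h.θ_pos
  have hs := h.sqrt_pos
  have hρ := h.ρ_nonneg
  rw [div_sub_div _ _ hq0.ne' hq0'.ne', abs_div, abs_of_pos (mul_pos hq0 hq0'), one_mul, mul_one,
    abs_sub_comm]
  calc |√(energy W e) - √(energy W₀ e)| / (√(energy W e) * √(energy W₀ e))
      ≤ ρ / ((θ * √(m : ℝ)) * (θ * √(m : ℝ))) := by
        gcongr
        exact h.abs_sqrt_energy_sub_le hW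
    _ = ρ / θ ^ 2 / m := by
        rw [mul_mul_mul_comm, h.sqrt_mul_sqrt, div_div, sq]

/-- On the ball, the gradient coefficients stay close in `ℓ¹` to the leading coefficients at
initialization.  A flipped gate costs `O(1/√m)`, and only `O(√m)` gates can flip; the change of
the normalization and the second term of the gradient cost `O(1/m)` per neuron on average. -/
lemma sum_abs_outCoef_sub_le (h : RegularInit A θ L ρ c W₀ e)
    (hW : ∀ r, ‖W r - W₀ r‖ ≤ ρ / √(m : ℝ)) (hM : |output c W e| ≤ M) :
    ∑ r, |outCoef c W e r - leadCoef c W₀ e r| ≤ A * L / θ + A * ρ / θ ^ 2 + M / θ := by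
  have hq := h.le_sqrt_energy_of_ball hW
  have hq0 := h.sqrt_energy_pos hW
  have hA := h.A_nonneg
  have hθ := h.θ_pos
  have hs := h.sqrt_pos
  have hρ := h.ρ_nonneg
  have hM0 := (abs_nonneg _).trans hM
  have hm : (0 : ℝ) < m := by exact_mod_cast h.m_pos
  -- `f₁`: flipped gates; `f₂`: the change of `√S`; `f₃`: the part of the gradient that comes
  -- from differentiating `√S`
  set f₁ : Fin m → ℝ := fun r =>
    (1 / √(m : ℝ)) * c r * ((gate ⟪W r, e⟫ - gate ⟪W₀ r, e⟫) / √(energy W e)) with hf₁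
  set f₂ : Fin m → ℝ := fun r =>
    (1 / √(m : ℝ)) * c r * (gate ⟪W₀ r, e⟫ * (1 / √(energy W e) - 1 / √(energy W₀ e))) with hf₂
  set f₃ : Fin m → ℝ := fun r =>
    gate ⟪W r, e⟫ * (relu ⟪W r, e⟫ * output c W e / √(energy W e) ^ 2) with hf₃
  have hc : ∀ r, |1 / √(m : ℝ) * c r| ≤ A := fun r => by
    rw [abs_mul, abs_of_pos (by positivity : 0 < 1 / √(m : ℝ))]
    exact h.abs_coeff_div_le r
  have hdec : ∀ r, |outCoef c W e r - leadCoef c W₀ e r| ≤ |f₁ r| + |f₂ r| + |f₃ r| := by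
    intro r
    have : outCoef c W e r - leadCoef c W₀ e r = f₁ r + f₂ r - f₃ r := by
      rw [outCoef_eq, leadCoef, leadCoef, hf₁, hf₂, hf₃]
      ring
    rw [this]
    exact (abs_sub _ _).trans (add_le_add (abs_add_le _ _) le_rfl)
  have h₁ : ∑ r, |f₁ r| ≤ A * L / θ := by
    have hb : ∀ r, |f₁ r| ≤ A * (1 / (θ * √(m : ℝ))) := fun r => by
      rw [hf₁]
      simp only
      rw [abs_mul, abs_div, abs_of_pos hq0]
      gcongr
      · exact hc r
      · exact abs_gate_sub_gate_le_one _ _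
    refine (h.sum_abs_le_of_support hb (by positivity) fun r hr => ?_).trans (le_of_eq ?_)
    · simp only [hf₁, gate, h.inner_nonneg_iff_of_ball hW hr]
      simp
    · field_simp
  have h₂ : ∑ r, |f₂ r| ≤ A * ρ / θ ^ 2 := by
    have hb : ∀ r, |f₂ r| ≤ A * (1 * (ρ / θ ^ 2 / m)) := fun r => by
      rw [hf₂]
      simp only
      rw [abs_mul, abs_mul (gate _)]
      gcongr
      · exact hc r
      · exact abs_gate_le_one _
      · exact h.abs_inv_sqrt_energy_sub_le hW
    refine (Finset.sum_le_sum fun r _ => hb r).trans (le_of_eq ?_)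
    simp only [Finset.sum_const, Finset.card_univ, Fintype.card_fin, nsmul_eq_mul]
    field_simp
  have h₃ : ∑ r, |f₃ r| ≤ M / θ := by
    have hb : ∀ r, |f₃ r| ≤ relu ⟪W r, e⟫ * (M / √(energy W e) ^ 2) := fun r => by
      rw [hf₃]
      simp only
      rw [abs_mul, abs_div, abs_mul, abs_of_nonneg (relu_nonneg _), abs_of_pos (pow_pos hq0 2),
        mul_div_assoc]
      calc |gate ⟪W r, e⟫| * (relu ⟪W r, e⟫ * (|output c W e| / √(energy W e) ^ 2))
          ≤ 1 * (relu ⟪W r, e⟫ * (M / √(energy W e) ^ 2)) := by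
            have := relu_nonneg ⟪W r, e⟫
            gcongr
            exact abs_gate_le_one _
        _ = _ := one_mul _
    calc ∑ r, |f₃ r| ≤ (∑ r, relu ⟪W r, e⟫) * (M / √(energy W e) ^ 2) := by
          rw [Finset.sum_mul]
          exact Finset.sum_le_sum fun r _ => hb r
      _ ≤ (√(m : ℝ) * √(energy W e)) * (M / √(energy W e) ^ 2) := by
          gcongr
          exact sum_relu_le W e
      _ = √(m : ℝ) * M / √(energy W e) := by field_simp
      _ ≤ √(m : ℝ) * M / (θ * √(m : ℝ)) := by gcongr
      _ = M / θ := by field_simp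
  calc _ ≤ ∑ r, (|f₁ r| + |f₂ r| + |f₃ r|) := Finset.sum_le_sum fun r _ => hdec r
    _ = ∑ r, |f₁ r| + ∑ r, |f₂ r| + ∑ r, |f₃ r| := by
        rw [Finset.sum_add_distrib, Finset.sum_add_distrib]
    _ ≤ _ := add_le_add (add_le_add h₁ h₂) h₃

/-- On the ball, the output is affine in the weights up to an error of the order of the
increment, the slope being that of the leading coefficients at initialization. -/
lemma abs_output_sub_sub_le (h : RegularInit A θ L ρ c W₀ e)
    (hW : ∀ r, ‖W r - W₀ r‖ ≤ ρ / √(m : ℝ)) (hW' : ∀ r, ‖W' r - W₀ r‖ ≤ ρ / √(m : ℝ))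
    (hM : |output c W e| ≤ M) (hτ : ∀ r, ‖W' r - W r‖ ≤ τ) (hτ0 : 0 ≤ τ) :
    |output c W' e - output c W e - ∑ r, leadCoef c W₀ e r * ⟪W' r - W r, e⟫| ≤
      (A * L / θ + A * ρ / θ ^ 2 + M / θ) * τ := by
  have hq' := h.le_sqrt_energy_of_ball hW'
  have hq0 := h.sqrt_energy_pos hW
  have hq0' := h.sqrt_energy_pos hW'
  have hi := h.le_sqrt_energy_of_ball h.self_mem_ball
  have hi0 := h.sqrt_energy_pos h.self_mem_ball
  have hA := h.A_nonneg
  have hθ := h.θ_pos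
  have hs := h.sqrt_pos
  have hρ := h.ρ_nonneg
  have hM0 := (abs_nonneg _).trans hM
  have hm : (0 : ℝ) < m := by exact_mod_cast h.m_pos
  have hc : ∀ r, |1 / √(m : ℝ) * c r| ≤ A := fun r => by
    rw [abs_mul, abs_of_pos (by positivity : 0 < 1 / √(m : ℝ))]
    exact h.abs_coeff_div_le r
  have hΔ : ∀ r, |⟪W' r, e⟫ - ⟪W r, e⟫| ≤ τ := fun r =>
    abs_inner_sub_inner_le h.norm_eq_one (hτ r)
  -- `t₁`: the ReLU is linearized; `t₂`: `√S` at `W'` against `√S` at `W₀`; `t₃`: the increment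
  -- of the normalization between `W` and `W'`
  set t₁ : Fin m → ℝ := fun r => (1 / √(m : ℝ)) * c r *
    ((relu ⟪W' r, e⟫ - relu ⟪W r, e⟫ - gate ⟪W₀ r, e⟫ * (⟪W' r, e⟫ - ⟪W r, e⟫)) /
      √(energy W₀ e)) with ht₁
  set t₂ : Fin m → ℝ := fun r => (1 / √(m : ℝ)) * c r *
    ((relu ⟪W' r, e⟫ - relu ⟪W r, e⟫) * (1 / √(energy W' e) - 1 / √(energy W₀ e))) with ht₂
  set t₃ : ℝ := output c W e * ((√(energy W' e) - √(energy W e)) / √(energy W' e)) with ht₃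
  have hdec : output c W' e - output c W e - ∑ r, leadCoef c W₀ e r * ⟪W' r - W r, e⟫ =
      ∑ r, t₁ r + ∑ r, t₂ r - t₃ := by
    have e₁ : output c W e * ((√(energy W' e) - √(energy W e)) / √(energy W' e)) =
        output c W e - ∑ r, (1 / √(m : ℝ)) * c r * (relu ⟪W r, e⟫ / √(energy W' e)) := by
      have : ∑ r, (1 / √(m : ℝ)) * c r * (relu ⟪W r, e⟫ / √(energy W' e)) =
          (1 / √(m : ℝ)) * ((∑ l, c l * relu ⟪W l, e⟫) / √(energy W' e)) := by
        rw [Finset.sum_div, Finset.mul_sum]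
        exact Finset.sum_congr rfl fun r _ => by ring
      rw [this, output_eq]
      field_simp
    have e₂ : output c W' e =
        ∑ r, (1 / √(m : ℝ)) * c r * (relu ⟪W' r, e⟫ / √(energy W' e)) := by
      rw [output, Finset.mul_sum]
      exact Finset.sum_congr rfl fun r _ => by ring
    rw [ht₃, e₁, e₂, ← Finset.sum_add_distrib, sub_sub_eq_add_sub, sub_right_comm,
      ← Finset.sum_sub_distrib, ← Finset.sum_add_distrib]
    congr 1
    refine Finset.sum_congr rfl fun r _ => ?_
    rw [ht₁, ht₂, leadCoef, inner_sub_left]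
    ring
  have b₁ : |∑ r, t₁ r| ≤ A * L / θ * τ := by
    refine (Finset.abs_sum_le_sum_abs _ _).trans ?_
    have hb : ∀ r, |t₁ r| ≤ A * (τ / (θ * √(m : ℝ))) := fun r => by
      rw [ht₁]
      simp only
      rw [abs_mul, abs_div, abs_of_pos hi0]
      gcongr
      · exact hc r
      · exact (abs_relu_sub_relu_sub_gate_mul_le _ _ _).trans (hΔ r)
    refine (h.sum_abs_le_of_support hb (by positivity) fun r hr => ?_).trans (le_of_eq ?_)
    · have g := h.inner_nonneg_iff_of_ball hW hr
      have g' := h.inner_nonneg_iff_of_ball hW' hr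
      simp only [ht₁, relu, gate]
      split_ifs with h0
      · rw [max_eq_left (g.2 h0), max_eq_left (g'.2 h0)]
        simp
      · rw [max_eq_right (not_le.1 (mt g.1 h0)).le, max_eq_right (not_le.1 (mt g'.1 h0)).le]
        simp
    · field_simp
  have b₂ : |∑ r, t₂ r| ≤ A * ρ / θ ^ 2 * τ := by
    refine (Finset.abs_sum_le_sum_abs _ _).trans ?_
    have hb : ∀ r, |t₂ r| ≤ A * (τ * (ρ / θ ^ 2 / m)) := fun r => by
      rw [ht₂]
      simp only
      rw [abs_mul, abs_mul (relu _ - relu _)]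
      gcongr
      · exact hc r
      · exact (abs_relu_sub_relu_le _ _).trans (hΔ r)
      · exact h.abs_inv_sqrt_energy_sub_le hW'
    refine (Finset.sum_le_sum fun r _ => hb r).trans (le_of_eq ?_)
    simp only [Finset.sum_const, Finset.card_univ, Fintype.card_fin, nsmul_eq_mul]
    field_simp
  have b₃ : |t₃| ≤ M / θ * τ := by
    rw [ht₃, abs_mul, abs_div, abs_of_pos hq0']
    calc |output c W e| * (|√(energy W' e) - √(energy W e)| / √(energy W' e))
        ≤ M * (√(m : ℝ) * τ / (θ * √(m : ℝ))) := by
          gcongr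
          exact _root_.abs_sqrt_energy_sub_le h.norm_eq_one hτ hτ0
      _ = M / θ * τ := by field_simp
  rw [hdec]
  calc _ ≤ |∑ r, t₁ r| + |∑ r, t₂ r| + |t₃| :=
        (abs_sub _ _).trans (add_le_add (abs_add_le _ _) le_rfl)
    _ ≤ A * L / θ * τ + A * ρ / θ ^ 2 * τ + M / θ * τ := add_le_add (add_le_add b₁ b₂) b₃
    _ = _ := by ring

lemma abs_closedCoef_le (h : RegularInit A θ L ρ c W₀ e) (r : Fin m) :
    |closedCoef c W₀ e r| ≤ A / θ / √(m : ℝ) := by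
  have hn := normCorr_mem_Icc W₀ e r
  rw [closedCoef_eq, abs_mul, abs_of_nonneg hn.1]
  exact (mul_le_of_le_one_right (abs_nonneg _) hn.2).trans (h.abs_leadCoef_le h.self_mem_ball r)

/-- The correction `β_r` is negligible: its deviations `σ_r² / S` from one add up to at most one
over all neurons. -/
lemma sum_abs_closedCoef_sub_le (h : RegularInit A θ L ρ c W₀ e) :
    ∑ r, |closedCoef c W₀ e r - leadCoef c W₀ e r| ≤ A / θ / √(m : ℝ) := by
  have hA := h.A_nonneg
  have hθ := h.θ_pos
  have hb : ∀ r, |closedCoef c W₀ e r - leadCoef c W₀ e r| ≤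
      A / θ / √(m : ℝ) * (relu ⟪W₀ r, e⟫ / √(energy W₀ e)) ^ 2 := fun r => by
    have : closedCoef c W₀ e r - leadCoef c W₀ e r =
        -(leadCoef c W₀ e r * (relu ⟪W₀ r, e⟫ / √(energy W₀ e)) ^ 2) := by
      rw [closedCoef_eq, normCorr, div_pow, Real.sq_sqrt (energy_nonneg W₀ e)]; ring
    rw [this, abs_neg, abs_mul, abs_of_nonneg (sq_nonneg (relu ⟪W₀ r, e⟫ / √(energy W₀ e)))]
    gcongr
    exact h.abs_leadCoef_le h.self_mem_ball r
  refine (Finset.sum_le_sum fun r _ => hb r).trans ?_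
  rw [← Finset.mul_sum]
  exact mul_le_of_le_one_right (by positivity) (sum_sq_relu_div_sqrt_energy_le W₀ e)

end RegularInit

end Network

/-! ### Gradient descent near the frozen kernel -/

lemma norm_le_of_forall_abs_le {n : ℕ} {v : EuclideanSpace ℝ (Fin n)} {b : ℝ}
    (h : ∀ i, |v i| ≤ b) : ‖v‖ ≤ n * b := by
  calc ‖v‖ = ‖∑ i, EuclideanSpace.single i (v i)‖ := by
        congr 1
        ext j
        simp [Finset.sum_apply, Pi.single_apply]
    _ ≤ ∑ i, ‖EuclideanSpace.single i (v i)‖ := norm_sum_le _ _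
    _ ≤ ∑ _i : Fin n, b := Finset.sum_le_sum fun i _ => by simpa using h i
    _ = n * b := by simp

/-- The `ℓ∞`-`ℓ¹` bound for kernel perturbations.  Features that differ in `O(√m)` entries of size
`O(1/√m)` are only `O(m^{-1/4})`-close in `ℓ²`, but their Gram matrices are `O(1/√m)`-close. -/
lemma abs_sum_mul_sub_sum_mul_le {m : ℕ} {f g f' g' : Fin m → ℝ} {b s s' : ℝ} (hb : 0 ≤ b)
    (hf : ∀ r, |f r| ≤ b) (hg' : ∀ r, |g' r| ≤ b) (hff : ∑ r, |f r - f' r| ≤ s)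
    (hgg : ∑ r, |g r - g' r| ≤ s') :
    |∑ r, f r * g r - ∑ r, f' r * g' r| ≤ b * (s + s') := by
  rw [← Finset.sum_sub_distrib]
  calc |∑ r, (f r * g r - f' r * g' r)| ≤ ∑ r, |f r * g r - f' r * g' r| :=
        Finset.abs_sum_le_sum_abs _ _
    _ ≤ ∑ r, (b * |f r - f' r| + b * |g r - g' r|) := by
        refine Finset.sum_le_sum fun r _ => ?_
        have : f r * g r - f' r * g' r = (f r - f' r) * g' r + f r * (g r - g' r) := by ring
        rw [this]
        refine (abs_add_le _ _).trans ?_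
        rw [abs_mul, abs_mul, mul_comm |f r - f' r|]
        gcongr
        · exact hg' r
        · exact hf r
    _ = b * (∑ r, |f r - f' r| + ∑ r, |g r - g' r|) := by
        rw [Finset.sum_add_distrib, ← Finset.mul_sum, ← Finset.mul_sum, mul_add]
    _ ≤ b * (s + s') := by gcongr

section Dynamics

variable {d m n : ℕ}

/-- The kernel of the leading features, the Gram matrix of the vectors `leadCoef • e_i`. -/
noncomputable def leadKernel (e : Fin n → EuclideanSpace ℝ (Fin d)) (c : Fin m → ℝ)
    (W : Fin m → EuclideanSpace ℝ (Fin d)) (i j : Fin n) : ℝ :=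
  ⟪e i, e j⟫ * ∑ r, leadCoef c W (e i) r * leadCoef c W (e j) r

lemma abs_inner_le_one {e e' : EuclideanSpace ℝ (Fin d)} (he : ‖e‖ = 1) (he' : ‖e'‖ = 1) :
    |⟪e, e'⟫| ≤ 1 := by
  simpa [he, he'] using abs_real_inner_le_norm e e'

namespace RegularInit

variable {A θ L ρ M B s η : ℝ} {c : Fin m → ℝ} {W₀ W : Fin m → EuclideanSpace ℝ (Fin d)}
  {e : Fin n → EuclideanSpace ℝ (Fin d)} {y : EuclideanSpace ℝ (Fin n)}

lemma abs_ntk_sub_leadKernel_le (h : ∀ i, RegularInit A θ L ρ c W₀ (e i))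
    (hM : ∀ i, |output c W₀ (e i)| ≤ M) (i j : Fin n) :
    |ntk e c W₀ i j - leadKernel e c W₀ i j| ≤
      (A + M) / θ / √(m : ℝ) * (2 * (A * L / θ + A * ρ / θ ^ 2 + M / θ)) := by
  have hM0 := (abs_nonneg _).trans (hM i)
  have hA := (h i).A_nonneg
  have hθ := (h i).θ_pos
  rw [ntk_apply_eq, leadKernel, ← mul_sub, abs_mul, two_mul]
  refine (mul_le_of_le_one_left (abs_nonneg _)
    (abs_inner_le_one (h i).norm_eq_one (h j).norm_eq_one)).trans ?_
  refine abs_sum_mul_sub_sum_mul_le (by positivity)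
    (fun r => (h i).abs_outCoef_le (h i).self_mem_ball (hM i) r)
    (fun r => ((h j).abs_leadCoef_le (h j).self_mem_ball r).trans (by gcongr; linarith))
    ((h i).sum_abs_outCoef_sub_le (h i).self_mem_ball (hM i))
    ((h j).sum_abs_outCoef_sub_le (h j).self_mem_ball (hM j))

lemma abs_ntkClosed_sub_leadKernel_le (h : ∀ i, RegularInit A θ L ρ c W₀ (e i)) (i j : Fin n) :
    |ntkClosed e c W₀ i j - leadKernel e c W₀ i j| ≤ A / θ / √(m : ℝ) * (2 * (A / θ)) := by
  have hA := (h i).A_nonneg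
  have hθ := (h i).θ_pos
  have hm : (1 : ℝ) ≤ √(m : ℝ) := Real.one_le_sqrt.2 (by exact_mod_cast (h i).m_pos)
  have hs : A / θ / √(m : ℝ) ≤ A / θ := div_le_self (by positivity) hm
  rw [ntkClosed_apply_eq, leadKernel, ← mul_sub, abs_mul, two_mul]
  refine (mul_le_of_le_one_left (abs_nonneg _)
    (abs_inner_le_one (h i).norm_eq_one (h j).norm_eq_one)).trans ?_
  exact abs_sum_mul_sub_sum_mul_le (by positivity) (fun r => (h i).abs_closedCoef_le r)
    (fun r => (h j).abs_leadCoef_le (h j).self_mem_ball r)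
    ((h i).sum_abs_closedCoef_sub_le.trans hs) ((h j).sum_abs_closedCoef_sub_le.trans hs)

lemma norm_lossGrad_le (h : ∀ i, RegularInit A θ L ρ c W₀ (e i))
    (hW : ∀ r, ‖W r - W₀ r‖ ≤ ρ / √(m : ℝ)) (hM : ∀ i, |output c W (e i)| ≤ M) (r : Fin m) :
    ‖lossGrad e y c W r‖ ≤ n * ((A + M) / θ / √(m : ℝ)) * ‖predictions e c W - y‖ := by
  rw [lossGrad]
  calc _ ≤ ∑ i, ‖(predictions e c W i - y i) • outputGrad c W (e i) r‖ := norm_sum_le _ _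
    _ ≤ ∑ _i : Fin n, ‖predictions e c W - y‖ * ((A + M) / θ / √(m : ℝ)) := by
        refine Finset.sum_le_sum fun i _ => ?_
        rw [norm_smul, outputGrad_eq_outCoef_smul, norm_smul, (h i).norm_eq_one, mul_one]
        gcongr
        · exact PiLp.norm_apply_le (predictions e c W - y) i
        · exact (h i).abs_outCoef_le hW (hM i) r
    _ = _ := by simp; ring

/-- One step of gradient descent is a step of the linear recursion `z ↦ z - η H z`, up to an
error of relative size `η / √m`. -/
lemma norm_step_sub_le (h : ∀ i, RegularInit A θ L ρ c W₀ (e i))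
    (hW : ∀ r, ‖W r - W₀ r‖ ≤ ρ / √(m : ℝ)) (hM : ∀ i, |output c W (e i)| ≤ M)
    (hη : 0 ≤ η) (hW' : ∀ r, ‖W r - η • lossGrad e y c W r - W₀ r‖ ≤ ρ / √(m : ℝ))
    (hB : (A + M) / θ ≤ B) (hs : A * L / θ + A * ρ / θ ^ 2 + M / θ ≤ s)
    {H : Matrix (Fin n) (Fin n) ℝ}
    (hH : ∀ i j, |H i j - leadKernel e c W₀ i j| ≤ B / √(m : ℝ) * (2 * s)) :
    ‖predictions e c (fun r => W r - η • lossGrad e y c W r) - y -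
        (predictions e c W - y - η • Matrix.toEuclideanCLM (𝕜 := ℝ) H (predictions e c W - y))‖ ≤
      η * (4 * n ^ 2 * B * s / √(m : ℝ)) * ‖predictions e c W - y‖ := by
  set W' : Fin m → EuclideanSpace ℝ (Fin d) := fun r => W r - η • lossGrad e y c W r with hW'd
  set z : EuclideanSpace ℝ (Fin n) := predictions e c W - y with hz
  suffices hi : ∀ i, |(predictions e c W' - y -
      (z - η • Matrix.toEuclideanCLM (𝕜 := ℝ) H z)) i| ≤
        η * (4 * n * B * s / √(m : ℝ)) * ‖z‖ by
    refine (norm_le_of_forall_abs_le hi).trans (le_of_eq ?_)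
    ring
  intro i
  have hM0 := (abs_nonneg _).trans (hM i)
  have hA := (h i).A_nonneg
  have hθ := (h i).θ_pos
  have hB0 : 0 ≤ B := le_trans (by positivity) hB
  have hb0 : 0 ≤ B / √(m : ℝ) := by positivity
  have hs0 : 0 ≤ s := le_trans (Finset.sum_nonneg fun _ _ => abs_nonneg _)
    (((h i).sum_abs_outCoef_sub_le hW (hM i)).trans hs)
  have hzj : ∀ j, |z j| ≤ ‖z‖ := fun j => PiLp.norm_apply_le z j
  have hout : ∀ j r, |outCoef c W (e j) r| ≤ B / √(m : ℝ) := fun j r =>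
    ((h j).abs_outCoef_le hW (hM j) r).trans (by gcongr)
  set τ : ℝ := η * (n * (B / √(m : ℝ)) * ‖z‖) with hτd
  have hτ : ∀ r, ‖W' r - W r‖ ≤ τ := fun r => by
    have : W' r - W r = -(η • lossGrad e y c W r) := by rw [hW'd]; simp
    rw [this, norm_neg, norm_smul, Real.norm_of_nonneg hη]
    refine mul_le_mul_of_nonneg_left ((norm_lossGrad_le h hW hM r).trans ?_) hη
    gcongr
  have hlin := ((h i).abs_output_sub_sub_le hW hW' (hM i) hτ (by positivity)).trans
    (mul_le_mul_of_nonneg_right hs (by positivity))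
  -- the mixed kernel: leading features at `W₀` against actual features at `W`
  set Q : Fin n → ℝ := fun j =>
    ⟪e j, e i⟫ * ∑ r, leadCoef c W₀ (e i) r * outCoef c W (e j) r with hQ
  have hsum : ∑ r, leadCoef c W₀ (e i) r * ⟪W' r - W r, e i⟫ = -(η * ∑ j, Q j * z j) := by
    have : ∀ r, leadCoef c W₀ (e i) r * ⟪W' r - W r, e i⟫ =
        -(η * ∑ j, ⟪e j, e i⟫ * (leadCoef c W₀ (e i) r * outCoef c W (e j) r) * z j) := by
      intro r
      have : W' r - W r = -(η • lossGrad e y c W r) := by rw [hW'd]; simp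
      rw [this, inner_neg_left, real_inner_smul_left, lossGrad, sum_inner, mul_neg, neg_inj,
        mul_left_comm, Finset.mul_sum]
      congr 1
      refine Finset.sum_congr rfl fun j _ => ?_
      rw [real_inner_smul_left, outputGrad_eq_outCoef_smul, real_inner_smul_left, hz]
      simp only [PiLp.sub_apply]
      ring
    simp_rw [this, Finset.sum_neg_distrib, ← Finset.mul_sum]
    rw [Finset.sum_comm]
    simp only [hQ, Finset.mul_sum, Finset.sum_mul]
  have hQH : ∀ j, |H i j - Q j| ≤ B / √(m : ℝ) * (3 * s) := by
    intro j
    have h1 : |leadKernel e c W₀ i j - Q j| ≤ B / √(m : ℝ) * (0 + s) := by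
      rw [hQ, leadKernel]
      simp only
      rw [real_inner_comm (e i) (e j), ← mul_sub, abs_mul, abs_sub_comm]
      refine (mul_le_of_le_one_left (abs_nonneg _)
        (abs_inner_le_one (h i).norm_eq_one (h j).norm_eq_one)).trans ?_
      have hlead : ∀ j r, |leadCoef c W₀ (e j) r| ≤ B / √(m : ℝ) := fun j r =>
        ((h j).abs_leadCoef_le (h j).self_mem_ball r).trans (by
          refine div_le_div_of_nonneg_right (le_trans ?_ hB) (Real.sqrt_nonneg _)
          gcongr; linarith)
      exact abs_sum_mul_sub_sum_mul_le hb0 (hlead i) (hlead j) (by simp)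
        (((h j).sum_abs_outCoef_sub_le hW (hM j)).trans hs)
    calc |H i j - Q j| ≤ |H i j - leadKernel e c W₀ i j| + |leadKernel e c W₀ i j - Q j| :=
          abs_sub_le _ _ _
      _ ≤ B / √(m : ℝ) * (2 * s) + B / √(m : ℝ) * (0 + s) := add_le_add (hH i j) h1
      _ = _ := by ring
  have hHz : |∑ j, (H i j - Q j) * z j| ≤ n * (B / √(m : ℝ) * (3 * s) * ‖z‖) := by
    refine (Finset.abs_sum_le_sum_abs _ _).trans ?_
    calc _ ≤ ∑ _j : Fin n, B / √(m : ℝ) * (3 * s) * ‖z‖ := by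
          refine Finset.sum_le_sum fun j _ => ?_
          rw [abs_mul]
          gcongr
          · exact hQH j
          · exact hzj j
      _ = _ := by simp
  have hcoord : (predictions e c W' - y - (z - η • Matrix.toEuclideanCLM (𝕜 := ℝ) H z)) i =
      (output c W' (e i) - output c W (e i) -
        ∑ r, leadCoef c W₀ (e i) r * ⟪W' r - W r, e i⟫) + η * ∑ j, (H i j - Q j) * z j := by
    have hT : (Matrix.toEuclideanCLM (𝕜 := ℝ) H z) i = ∑ j, H i j * z j := by
      simp [Matrix.ofLp_toEuclideanCLM, Matrix.mulVec, dotProduct]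
    rw [hsum]
    simp only [PiLp.sub_apply, PiLp.smul_apply, smul_eq_mul, hT, sub_mul,
      Finset.sum_sub_distrib]
    rw [hz]
    simp only [PiLp.sub_apply, predictions]
    ring
  rw [hcoord]
  refine (abs_add_le _ _).trans ?_
  rw [abs_mul, abs_of_nonneg hη]
  refine (add_le_add hlin (mul_le_mul_of_nonneg_left hHz hη)).trans (le_of_eq ?_)
  rw [hτd]
  ring

/-- While the residual decays geometrically the weights stay in the ball of radius `ρ / √m`, and
while they stay there the residual decays geometrically and follows the linear recursion. -/
lemma gd_tracks_linear (h : ∀ i, RegularInit A θ L ρ c W₀ (e i)) {D μ : ℝ}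
    (hB : (A + M) / θ ≤ B) (hs : A * L / θ + A * ρ / θ ^ 2 + M / θ ≤ s)
    {H : Matrix (Fin n) (Fin n) ℝ}
    (hH : ∀ i j, |H i j - leadKernel e c W₀ i j| ≤ B / √(m : ℝ) * (2 * s))
    (hμ : 0 < μ) (hη : 0 < η) (hημ : η * μ ≤ 1)
    (hcontr : ∀ v, ‖v - η • Matrix.toEuclideanCLM (𝕜 := ℝ) H v‖ ≤ (1 - η * μ) * ‖v‖)
    (hD : ‖predictions e c W₀ - y‖ ≤ D) (hyM : ∀ i, D + |y i| ≤ M)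
    (hρ : n * B * D * (2 / μ) ≤ ρ) (hlarge : 4 * n ^ 2 * B * s / √(m : ℝ) ≤ μ / 2) (k : ℕ) :
    ‖predictions e c (gdWeights e y c η W₀ k) - y -
        (fun v => v - η • Matrix.toEuclideanCLM (𝕜 := ℝ) H v)^[k] (predictions e c W₀ - y)‖ ≤
      4 * n ^ 2 * B * s / √(m : ℝ) * D * (2 / μ) := by
  obtain rfl | hn := Nat.eq_zero_or_pos n
  · simp [Subsingleton.elim (α := EuclideanSpace ℝ (Fin 0)) (_ - _) 0]
  set i₀ : Fin n := ⟨0, hn⟩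
  set G : EuclideanSpace ℝ (Fin n) → EuclideanSpace ℝ (Fin n) :=
    fun v => v - η • Matrix.toEuclideanCLM (𝕜 := ℝ) H v with hG
  -- half of the contraction rate `η μ` is given away to absorb the perturbation
  set q : ℝ := 1 - η * μ / 2 with hq
  set E : ℝ := 4 * n ^ 2 * B * s / √(m : ℝ) with hE
  set Z : ℕ → EuclideanSpace ℝ (Fin n) := fun k => predictions e c (gdWeights e y c η W₀ k) - y
    with hZ
  have hD0 : 0 ≤ D := (norm_nonneg _).trans hD
  have hM0 : 0 ≤ M := (add_nonneg hD0 (abs_nonneg _)).trans (hyM i₀)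
  have hA := (h i₀).A_nonneg
  have hθ := (h i₀).θ_pos
  have hm := (h i₀).sqrt_pos
  have hB0 : 0 ≤ B := le_trans (by positivity) hB
  have hq0 : 0 ≤ q := by rw [hq]; linarith
  have hq1 : q ≤ 1 := by rw [hq]; linarith [mul_pos hη hμ]
  have hs0 : 0 ≤ s := by
    have hM₀ : |output c W₀ (e i₀)| ≤ M := by
      have h1 := (PiLp.norm_apply_le (predictions e c W₀ - y) i₀).trans hD
      have h2 : output c W₀ (e i₀) = (predictions e c W₀ - y) i₀ + y i₀ := by simp [predictions]
      rw [h2]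
      exact (abs_add_le _ _).trans ((add_le_add h1 le_rfl).trans (hyM i₀))
    exact le_trans (Finset.sum_nonneg fun _ _ => abs_nonneg _)
      (((h i₀).sum_abs_outCoef_sub_le (h i₀).self_mem_ball hM₀).trans hs)
  have hE0 : 0 ≤ E := by rw [hE]; positivity
  -- `η ∑_{j < k} q ^ j = (2 / μ) (1 - q ^ k)`, in recursive form
  have hgeom : ∀ k : ℕ, 2 / μ * (1 - q ^ k) + η * q ^ k = 2 / μ * (1 - q ^ (k + 1)) := by
    intro k
    rw [pow_succ, hq]
    field_simp
    ring
  have hle1 : ∀ k : ℕ, 2 / μ * (1 - q ^ k) ≤ 2 / μ := fun k => by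
    refine mul_le_of_le_one_right (by positivity) ?_
    linarith [pow_nonneg hq0 k]
  have hball : ∀ (k : ℕ) (r : Fin m), ‖gdWeights e y c η W₀ k r - W₀ r‖ ≤
      n * (B / √(m : ℝ)) * D * (2 / μ * (1 - q ^ k)) →
      ‖gdWeights e y c η W₀ k r - W₀ r‖ ≤ ρ / √(m : ℝ) := by
    intro k r hk
    refine hk.trans ?_
    calc n * (B / √(m : ℝ)) * D * (2 / μ * (1 - q ^ k)) ≤ n * (B / √(m : ℝ)) * D * (2 / μ) := by
          gcongr
          exact hle1 k
      _ = n * B * D * (2 / μ) / √(m : ℝ) := by ring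
      _ ≤ ρ / √(m : ℝ) := by gcongr
  have key : ∀ k : ℕ, ‖Z k‖ ≤ q ^ k * D ∧
      (∀ r, ‖gdWeights e y c η W₀ k r - W₀ r‖ ≤
        n * (B / √(m : ℝ)) * D * (2 / μ * (1 - q ^ k))) ∧
      ‖Z k - G^[k] (Z 0)‖ ≤ E * D * (2 / μ * (1 - q ^ k)) := by
    intro k
    induction k with
    | zero => refine ⟨?_, fun r => ?_, ?_⟩ <;> simp [hZ, gdWeights, hD]
    | succ k ih =>
      obtain ⟨ih1, ih2, ih3⟩ := ih
      have hZD : ‖Z k‖ ≤ D := ih1.trans (mul_le_of_le_one_left hD0 (pow_le_one₀ hq0 hq1))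
      have hM : ∀ i, |output c (gdWeights e y c η W₀ k) (e i)| ≤ M := fun i => by
        have h1 := (PiLp.norm_apply_le (Z k) i).trans hZD
        have h2 : output c (gdWeights e y c η W₀ k) (e i) = Z k i + y i := by
          simp [hZ, predictions]
        rw [h2]
        exact (abs_add_le _ _).trans ((add_le_add h1 le_rfl).trans (hyM i))
      have hW := fun r => hball k r (ih2 r)
      have hmove : ∀ r, ‖gdWeights e y c η W₀ (k + 1) r - W₀ r‖ ≤
          n * (B / √(m : ℝ)) * D * (2 / μ * (1 - q ^ (k + 1))) := by
        intro r
        have hstep : ‖η • lossGrad e y c (gdWeights e y c η W₀ k) r‖ ≤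
            n * (B / √(m : ℝ)) * D * (η * q ^ k) := by
          rw [norm_smul, Real.norm_of_nonneg hη.le]
          calc _ ≤ η * (n * ((A + M) / θ / √(m : ℝ)) * ‖Z k‖) := by
                gcongr
                exact norm_lossGrad_le h hW hM r
            _ ≤ η * (n * (B / √(m : ℝ)) * (q ^ k * D)) := by gcongr
            _ = _ := by ring
        rw [← hgeom, mul_add]
        have : gdWeights e y c η W₀ (k + 1) r - W₀ r = gdWeights e y c η W₀ k r - W₀ r -
            η • lossGrad e y c (gdWeights e y c η W₀ k) r := by
          simp only [gdWeights]; abel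
        rw [this]
        exact (norm_sub_le _ _).trans (add_le_add (ih2 r) hstep)
      have herr : ‖Z (k + 1) - G (Z k)‖ ≤ η * E * ‖Z k‖ :=
        norm_step_sub_le h hW hM hη.le (fun r => hball (k + 1) r (hmove r)) hB hs hH
      refine ⟨?_, hmove, ?_⟩
      · calc ‖Z (k + 1)‖ = ‖G (Z k) + (Z (k + 1) - G (Z k))‖ := by rw [add_sub_cancel]
          _ ≤ (1 - η * μ) * ‖Z k‖ + η * E * ‖Z k‖ :=
              (norm_add_le _ _).trans (add_le_add (hcontr _) herr)
          _ ≤ (1 - η * μ) * ‖Z k‖ + η * (μ / 2) * ‖Z k‖ := by gcongr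
          _ = q * ‖Z k‖ := by rw [hq]; ring
          _ ≤ q * (q ^ k * D) := by gcongr
          _ = q ^ (k + 1) * D := by ring
      · rw [Function.iterate_succ_apply', ← hgeom]
        have hlin : G (Z k) - G (G^[k] (Z 0)) = G (Z k - G^[k] (Z 0)) := by
          simp only [hG, map_sub, smul_sub]; abel
        calc ‖Z (k + 1) - G (G^[k] (Z 0))‖
            = ‖G (Z k - G^[k] (Z 0)) + (Z (k + 1) - G (Z k))‖ := by rw [← hlin]; congr 1; abel
          _ ≤ (1 - η * μ) * ‖Z k - G^[k] (Z 0)‖ + η * E * ‖Z k‖ :=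
              (norm_add_le _ _).trans (add_le_add (hcontr _) herr)
          _ ≤ 1 * (E * D * (2 / μ * (1 - q ^ k))) + η * E * (q ^ k * D) := by
              gcongr
              linarith [mul_pos hη hμ]
          _ = E * D * (2 / μ * (1 - q ^ k) + η * q ^ k) := by ring
  refine (key k).2.2.trans ?_
  gcongr
  exact hle1 k

end RegularInit

end Dynamics

/-! ### Invariance under rescaling of the inputs -/

section Homogeneity

variable {d m n : ℕ}

lemma relu_mul {t : ℝ} (ht : 0 ≤ t) (s : ℝ) : relu (t * s) = t * relu s := by
  rw [relu, relu, mul_max_of_nonneg _ _ ht, mul_zero]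

lemma gate_mul {t : ℝ} (ht : 0 < t) (s : ℝ) : gate (t * s) = gate s := by
  simp [gate, mul_nonneg_iff_of_pos_left ht]

lemma energy_smul {t : ℝ} (ht : 0 ≤ t) (W : Fin m → EuclideanSpace ℝ (Fin d))
    (x : EuclideanSpace ℝ (Fin d)) : energy W (t • x) = t ^ 2 * energy W x := by
  simp only [energy, real_inner_smul_right, relu_mul ht, mul_pow, Finset.mul_sum]

lemma sqrt_energy_smul {t : ℝ} (ht : 0 ≤ t) (W : Fin m → EuclideanSpace ℝ (Fin d))
    (x : EuclideanSpace ℝ (Fin d)) : √(energy W (t • x)) = t * √(energy W x) := by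
  rw [energy_smul ht, Real.sqrt_mul (sq_nonneg t), Real.sqrt_sq ht]

lemma output_smul {t : ℝ} (ht : 0 < t) (c : Fin m → ℝ) (W : Fin m → EuclideanSpace ℝ (Fin d))
    (x : EuclideanSpace ℝ (Fin d)) : output c W (t • x) = output c W x := by
  simp only [output, real_inner_smul_right, relu_mul ht.le, sqrt_energy_smul ht.le,
    mul_div_mul_left _ _ ht.ne']

/-- The leading coefficient is homogeneous of degree `-1`: it multiplies the input in the
gradient, which is therefore invariant. -/
lemma leadCoef_smul {t : ℝ} (ht : 0 < t) (c : Fin m → ℝ) (W : Fin m → EuclideanSpace ℝ (Fin d))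
    (x : EuclideanSpace ℝ (Fin d)) (r : Fin m) :
    leadCoef c W (t • x) r = t⁻¹ * leadCoef c W x r := by
  simp only [leadCoef, real_inner_smul_right, gate_mul ht, sqrt_energy_smul ht.le]
  rw [← div_div]
  ring

lemma normCorr_smul {t : ℝ} (ht : 0 < t) (W : Fin m → EuclideanSpace ℝ (Fin d))
    (x : EuclideanSpace ℝ (Fin d)) (r : Fin m) : normCorr W (t • x) r = normCorr W x r := by
  simp only [normCorr, real_inner_smul_right, relu_mul ht.le, energy_smul ht.le, mul_pow]
  rw [mul_div_mul_left _ _ (pow_ne_zero 2 ht.ne')]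

lemma closedCoef_smul {t : ℝ} (ht : 0 < t) (c : Fin m → ℝ)
    (W : Fin m → EuclideanSpace ℝ (Fin d)) (x : EuclideanSpace ℝ (Fin d)) (r : Fin m) :
    closedCoef c W (t • x) r = t⁻¹ * closedCoef c W x r := by
  rw [closedCoef_eq, closedCoef_eq, leadCoef_smul ht, normCorr_smul ht, mul_assoc]

lemma outputGrad_smul {t : ℝ} (ht : 0 < t) (c : Fin m → ℝ)
    (W : Fin m → EuclideanSpace ℝ (Fin d)) (x : EuclideanSpace ℝ (Fin d)) (r : Fin m) :
    outputGrad c W (t • x) r = outputGrad c W x r := by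
  rw [outputGrad_eq_outCoef_smul, outputGrad_eq_outCoef_smul, smul_smul]
  congr 1
  rw [outCoef_eq, outCoef_eq, leadCoef_smul ht, output_smul ht, sqrt_energy_smul ht.le,
    real_inner_smul_right, gate_mul ht, relu_mul ht.le, mul_pow, sq t, mul_assoc t, mul_assoc t,
    mul_div_mul_left _ _ ht.ne', ← div_div, div_right_comm, div_eq_inv_mul _ t]
  rw [← mul_assoc, sub_mul]
  field_simp

variable (x : Fin n → EuclideanSpace ℝ (Fin d)) (c : Fin m → ℝ)
  (W : Fin m → EuclideanSpace ℝ (Fin d)) {t : Fin n → ℝ}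

lemma predictions_smul (ht : ∀ i, 0 < t i) :
    predictions (fun i => t i • x i) c W = predictions x c W := by
  simp only [predictions, output_smul (ht _)]

lemma gdWeights_smul (ht : ∀ i, 0 < t i) (y : EuclideanSpace ℝ (Fin n)) (η : ℝ)
    (k : ℕ) :
    gdWeights (fun i => t i • x i) y c η W k = gdWeights x y c η W k := by
  induction k with
  | zero => rfl
  | succ k ih =>
    simp only [gdWeights, ih, lossGrad, predictions_smul x c _ ht, outputGrad_smul (ht _)]

lemma ntk_smul (ht : ∀ i, 0 < t i) : ntk (fun i => t i • x i) c W = ntk x c W := by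
  simp only [ntk, outputGrad_smul (ht _)]

lemma ntkClosed_smul (ht : ∀ i, 0 < t i) :
    ntkClosed (fun i => t i • x i) c W = ntkClosed x c W := by
  ext i j
  rw [ntkClosed_apply_eq, ntkClosed_apply_eq, real_inner_smul_left, real_inner_smul_right,
    Finset.mul_sum, Finset.mul_sum]
  refine Finset.sum_congr rfl fun r _ => ?_
  rw [closedCoef_smul (ht i), closedCoef_smul (ht j)]
  have hi := (ht i).ne'
  have hj := (ht j).ne'
  field_simp

end Homogeneity

/-! ### Spectral facts -/

section Spectral

variable {n : ℕ}

lemma abs_apply_le_specNorm (A : Matrix (Fin n) (Fin n) ℝ) (i j : Fin n) :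
    |A i j| ≤ specNorm A := by
  have h : (Matrix.toEuclideanCLM (𝕜 := ℝ) A (EuclideanSpace.single j 1)) i = A i j := by
    simp [Matrix.ofLp_toEuclideanCLM]
  rw [← h, ← Real.norm_eq_abs]
  refine (PiLp.norm_apply_le _ i).trans ?_
  simpa [specNorm] using (Matrix.toEuclideanCLM (𝕜 := ℝ) A).le_opNorm (EuclideanSpace.single j 1)

lemma mul_norm_sq_le_inner_of_isLeast_spectrum {A : Matrix (Fin n) (Fin n) ℝ}
    (hA : A.IsHermitian) {μ : ℝ} (hμ : IsLeast (spectrum ℝ A) μ)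
    (w : EuclideanSpace ℝ (Fin n)) :
    μ * ‖w‖ ^ 2 ≤ ⟪w, Matrix.toEuclideanCLM (𝕜 := ℝ) A w⟫ := by
  have hB : (A - algebraMap ℝ _ μ).PosSemidef := by
    rw [Matrix.posSemidef_iff_isHermitian_and_spectrum_nonneg]
    refine ⟨hA.sub ?_, ?_⟩
    · rw [Matrix.algebraMap_eq_diagonal]
      exact Matrix.isHermitian_diagonal _
    · rw [← spectrum.sub_singleton_eq]
      rintro _ ⟨b, hb, c, rfl, rfl⟩
      exact sub_nonneg.2 (hμ.2 hb)
  have h := hB.dotProduct_mulVec_nonneg w.ofLp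
  have hw : w.ofLp ⬝ᵥ w.ofLp = ‖w‖ ^ 2 := by
    rw [EuclideanSpace.real_norm_sq_eq]
    simp [dotProduct, sq]
  rw [Matrix.inner_toEuclideanCLM]
  simp only [star_trivial, Matrix.sub_mulVec, dotProduct_sub, Algebra.algebraMap_eq_smul_one,
    Matrix.smul_mulVec, Matrix.one_mulVec, dotProduct_smul, smul_eq_mul, hw] at h
  linarith

/-- A perturbation of spectral norm at most `ν` lowers the quadratic form by at most `ν`. -/
lemma mul_norm_sq_le_inner_of_specNorm_sub_le {A A' : Matrix (Fin n) (Fin n) ℝ} {μ ν : ℝ}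
    (h : ∀ w, μ * ‖w‖ ^ 2 ≤ ⟪w, Matrix.toEuclideanCLM (𝕜 := ℝ) A w⟫)
    (hA' : specNorm (A' - A) ≤ ν) (w : EuclideanSpace ℝ (Fin n)) :
    (μ - ν) * ‖w‖ ^ 2 ≤ ⟪w, Matrix.toEuclideanCLM (𝕜 := ℝ) A' w⟫ := by
  have h1 : |⟪w, Matrix.toEuclideanCLM (𝕜 := ℝ) (A' - A) w⟫| ≤ ν * ‖w‖ ^ 2 := by
    refine (abs_real_inner_le_norm _ _).trans ?_
    have := ((Matrix.toEuclideanCLM (𝕜 := ℝ) (A' - A)).le_opNorm w).trans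
      (mul_le_mul_of_nonneg_right hA' (norm_nonneg w))
    calc _ ≤ ‖w‖ * (ν * ‖w‖) := by gcongr
      _ = ν * ‖w‖ ^ 2 := by ring
  rw [map_sub, sub_apply, inner_sub_right] at h1
  linarith [h w, (abs_le.1 h1).1]

variable {H : Matrix (Fin n) (Fin n) ℝ} {lam : Fin n → ℝ}
  {v : OrthonormalBasis (Fin n) ℝ (EuclideanSpace ℝ (Fin n))}

lemma inner_toEuclideanCLM_of_eq_sum
    (hH : H = ∑ i, lam i • Matrix.vecMulVec (v i) (v i)) (w : EuclideanSpace ℝ (Fin n))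
    (i : Fin n) : ⟪v i, Matrix.toEuclideanCLM (𝕜 := ℝ) H w⟫ = lam i * ⟪v i, w⟫ := by
  have hd : ∀ a b : EuclideanSpace ℝ (Fin n), a.ofLp ⬝ᵥ b.ofLp = ⟪a, b⟫ := fun a b => by
    simp [PiLp.inner_apply, dotProduct, mul_comm]
  rw [Matrix.inner_toEuclideanCLM, hH, Matrix.sum_mulVec, dotProduct_sum,
    Finset.sum_eq_single i]
  · rw [Matrix.smul_mulVec, Matrix.vecMulVec_mulVec]
    simp [hd, real_inner_smul_right]
  · intro j _ hj
    rw [Matrix.smul_mulVec, Matrix.vecMulVec_mulVec]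
    simp [hd, real_inner_smul_right, v.inner_eq_zero hj.symm]
  · simp

lemma inner_iterate_of_eq_sum
    (hH : H = ∑ i, lam i • Matrix.vecMulVec (v i) (v i)) (η : ℝ) (w : EuclideanSpace ℝ (Fin n))
    (i : Fin n) (k : ℕ) :
    ⟪v i, (fun u => u - η • Matrix.toEuclideanCLM (𝕜 := ℝ) H u)^[k] w⟫ =
      (1 - η * lam i) ^ k * ⟪v i, w⟫ := by
  induction k with
  | zero => simp
  | succ k ih =>
    rw [Function.iterate_succ_apply', inner_sub_right, real_inner_smul_right,
      inner_toEuclideanCLM_of_eq_sum hH, ih]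
    ring

lemma norm_iterate_of_eq_sum
    (hH : H = ∑ i, lam i • Matrix.vecMulVec (v i) (v i)) (η : ℝ) (w : EuclideanSpace ℝ (Fin n))
    (k : ℕ) :
    ‖(fun u => u - η • Matrix.toEuclideanCLM (𝕜 := ℝ) H u)^[k] w‖ =
      √(∑ i, (1 - η * lam i) ^ (2 * k) * ⟪v i, w⟫ ^ 2) := by
  rw [← Real.sqrt_sq (norm_nonneg ((fun u => u - η • _)^[k] w)), ← v.sum_sq_inner_right]
  simp only [inner_iterate_of_eq_sum hH, mul_pow, ← pow_mul, mul_comm 2 k]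

lemma norm_sub_smul_le_of_eq_sum
    (hH : H = ∑ i, lam i • Matrix.vecMulVec (v i) (v i)) {η μ : ℝ}
    (h0 : ∀ i, 0 ≤ 1 - η * lam i) (h1 : ∀ i, 1 - η * lam i ≤ 1 - η * μ) (hμ : 0 ≤ 1 - η * μ)
    (w : EuclideanSpace ℝ (Fin n)) :
    ‖w - η • Matrix.toEuclideanCLM (𝕜 := ℝ) H w‖ ≤ (1 - η * μ) * ‖w‖ := by
  have h := norm_iterate_of_eq_sum hH η w 1
  simp only [Function.iterate_one, mul_one] at h
  rw [h]
  refine Real.sqrt_le_iff.2 ⟨by positivity, ?_⟩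
  rw [mul_pow, ← v.sum_sq_inner_right w, Finset.mul_sum]
  refine Finset.sum_le_sum fun i _ => ?_
  have := h0 i
  exact mul_le_mul_of_nonneg_right (pow_le_pow_left₀ this (h1 i) 2) (sq_nonneg _)

lemma eigenvalue_bounds_of_eq_sum
    (hH : H = ∑ i, lam i • Matrix.vecMulVec (v i) (v i)) {μ : ℝ}
    (hlow : ∀ w, μ * ‖w‖ ^ 2 ≤ ⟪w, Matrix.toEuclideanCLM (𝕜 := ℝ) H w⟫) (i : Fin n) :
    μ ≤ lam i ∧ lam i ≤ specNorm H := by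
  have h1 : ⟪v i, Matrix.toEuclideanCLM (𝕜 := ℝ) H (v i)⟫ = lam i := by
    rw [inner_toEuclideanCLM_of_eq_sum hH]; simp
  have hn : ‖v i‖ = 1 := v.norm_eq_one i
  constructor
  · simpa [h1, hn] using hlow (v i)
  · rw [← h1]
    refine (real_inner_le_norm _ _).trans ?_
    simpa [hn, specNorm] using (Matrix.toEuclideanCLM (𝕜 := ℝ) H).le_opNorm (v i)

/-- Convergence in probability produces, for every tolerance, an outcome at which the kernel is
within that tolerance of its limit. -/
lemma HadamardNet.IsInfiniteWidthNTK.exists_specNorm_sub_lt {d : ℕ}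
    {H : ∀ m : ℕ, (Fin m → ℝ) → (Fin m → EuclideanSpace ℝ (Fin d)) → Matrix (Fin n) (Fin n) ℝ}
    {κ a : ℝ} {p : ∀ m : ℕ, Fin m → ℝ} {Hinf : Matrix (Fin n) (Fin n) ℝ}
    (h : IsInfiniteWidthNTK H κ a p Hinf) {ε : ℝ} (hε : 0 < ε) :
    ∃ m c W, specNorm (H m c W - Hinf) < ε := by
  obtain ⟨m, hm⟩ := ((h ε hε).eventually (gt_mem_nhds (zero_lt_one))).exists
  by_contra! hc
  refine hm.ne ?_
  rw [← measure_univ (μ := initLaw d κ a m)]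
  congr 1
  exact Set.eq_univ_of_forall fun ω => hc m _ _

lemma HadamardNet.IsInfiniteWidthNTK.isHermitian {d : ℕ}
    {H : ∀ m : ℕ, (Fin m → ℝ) → (Fin m → EuclideanSpace ℝ (Fin d)) → Matrix (Fin n) (Fin n) ℝ}
    {κ a : ℝ} {p : ∀ m : ℕ, Fin m → ℝ} {Hinf : Matrix (Fin n) (Fin n) ℝ}
    (h : IsInfiniteWidthNTK H κ a p Hinf) (hH : ∀ m c W i j, H m c W i j = H m c W j i) :
    Hinf.IsHermitian := by
  ext i j
  simp only [Matrix.conjTranspose_apply, star_trivial]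
  refine eq_of_forall_dist_le fun ε hε => ?_
  obtain ⟨m, c, W, hW⟩ := h.exists_specNorm_sub_lt (half_pos hε)
  have h1 := abs_le.1 ((abs_apply_le_specNorm _ i j).trans hW.le)
  have h2 := abs_le.1 ((abs_apply_le_specNorm _ j i).trans hW.le)
  simp only [Matrix.sub_apply, hH m c W j i] at h1 h2
  rw [Real.dist_eq, abs_le]
  constructor <;> linarith [h1.1, h1.2, h2.1, h2.2]

end Spectral

/-! ### The spectral formula -/

/-- From a regular initialization at unit inputs, gradient descent obeys the spectral formula of
the frozen kernel for all times. -/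
lemma RegularInit.exists_error {d m n : ℕ} {A θ L ρ M B s D μ η : ℝ} {c : Fin m → ℝ}
    {W₀ : Fin m → EuclideanSpace ℝ (Fin d)} {e : Fin n → EuclideanSpace ℝ (Fin d)}
    {y : EuclideanSpace ℝ (Fin n)} (h : ∀ i, RegularInit A θ L ρ c W₀ (e i))
    (hB : (A + M) / θ ≤ B) (hs : A * L / θ + A * ρ / θ ^ 2 + M / θ ≤ s)
    {H : Matrix (Fin n) (Fin n) ℝ}
    (hH : ∀ i j, |H i j - leadKernel e c W₀ i j| ≤ B / √(m : ℝ) * (2 * s))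
    (hμ : 0 < μ) (hlow : ∀ w, μ * ‖w‖ ^ 2 ≤ ⟪w, Matrix.toEuclideanCLM (𝕜 := ℝ) H w⟫)
    (hη : 0 < η) (hηH : η ≤ (specNorm H)⁻¹)
    (hD : ‖predictions e c W₀ - y‖ ≤ D) (hyM : ∀ i, D + |y i| ≤ M)
    (hρ : n * B * D * (2 / μ) ≤ ρ) (hlarge : 4 * n ^ 2 * B * s / √(m : ℝ) ≤ μ / 2)
    {lam : Fin n → ℝ} {v : OrthonormalBasis (Fin n) ℝ (EuclideanSpace ℝ (Fin n))}
    (hdec : H = ∑ i, lam i • Matrix.vecMulVec (v i) (v i)) :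
    ∃ ε : ℕ → ℝ, ∀ k,
      ‖predictions e c (gdWeights e y c η W₀ k) - y‖ =
        √(∑ i, (1 - η * lam i) ^ (2 * k) * (⟪v i, predictions e c W₀ - y⟫) ^ 2) + ε k ∧
      |ε k| ≤ 4 * n ^ 2 * B * s * D * (2 / μ) / √(m : ℝ) := by
  obtain rfl | hn := Nat.eq_zero_or_pos n
  · refine ⟨0, fun k => ?_⟩
    simp [Subsingleton.elim (α := EuclideanSpace ℝ (Fin 0)) (_ - _) 0]
  have hev := eigenvalue_bounds_of_eq_sum hdec hlow
  have hspec : 0 < specNorm H :=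
    hμ.trans_le ((hev ⟨0, hn⟩).1.trans (hev ⟨0, hn⟩).2)
  have hη1 : ∀ b, b ≤ specNorm H → η * b ≤ 1 := fun b hb =>
    (mul_le_mul_of_nonneg_left hb hη.le).trans (by
      simpa [hspec.ne'] using mul_le_mul_of_nonneg_right hηH hspec.le)
  have hημ : η * μ ≤ 1 := hη1 μ ((hev ⟨0, hn⟩).1.trans (hev ⟨0, hn⟩).2)
  have hcontr := norm_sub_smul_le_of_eq_sum hdec (η := η) (μ := μ)
    (fun i => sub_nonneg.2 (hη1 _ (hev i).2))
    (fun i => sub_le_sub_left (mul_le_mul_of_nonneg_left (hev i).1 hη.le) 1)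
    (sub_nonneg.2 hημ)
  refine ⟨fun k => ‖predictions e c (gdWeights e y c η W₀ k) - y‖ -
    √(∑ i, (1 - η * lam i) ^ (2 * k) * (⟪v i, predictions e c W₀ - y⟫) ^ 2), fun k =>
    ⟨by ring, ?_⟩⟩
  simp only [← norm_iterate_of_eq_sum hdec]
  refine (abs_norm_sub_norm_le _ _).trans
    ((gd_tracks_linear h hB hs hH hμ hη hημ hcontr hD hyM hρ hlarge k).trans (le_of_eq ?_))
  ring

/-- The three estimates at initialization hold together, at the unit inputs `e`, outside an event
of probability at most `3 n δ'`. -/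
lemma initLaw_not_regular_le {d m n : ℕ} {κ a P θ L ρ U δ' : ℝ} (hκ : 0 < κ) (ha : 0 < a)
    (hm : 0 < m) (hθ : 0 < θ) (hL : 0 < L) (hU : 0 < U) (hρ : 0 ≤ ρ)
    (hθq : (2 * θ) ^ 2 = κ ^ 2 * ((gaussianReal 0 (κ ^ 2).toNNReal).real (Set.Ici κ) / 2))
    (hmq : 4 / (m * (gaussianReal 0 (κ ^ 2).toNNReal).real (Set.Ici κ) ^ 2) ≤ δ')
    (hUδ : a ^ 2 * P ^ 2 / U ^ 2 ≤ δ') (hLδ : ρ / κ / L ≤ δ')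
    (hρθ : ρ ≤ θ * √(m : ℝ)) {p : Fin m → ℝ} (hp : ∀ r, |p r| ≤ P * √(m : ℝ))
    {e : Fin n → EuclideanSpace ℝ (Fin d)} (he : ∀ i, ‖e i‖ = 1) :
    initLaw d κ a m {ω | ¬ ∀ i, RegularInit (a * |P|) θ L ρ (coeffs ω.2 p) ω.1 (e i) ∧
      |output (coeffs ω.2 p) ω.1 (e i)| ≤ U} ≤ n * (3 * ENNReal.ofReal δ') := by
  have hsm : 0 < √(m : ℝ) := Real.sqrt_pos.2 (by exact_mod_cast hm)
  have hmm : √(m : ℝ) * √(m : ℝ) = m := Real.mul_self_sqrt (Nat.cast_nonneg m)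
  set S₀ : Set ((Fin m → EuclideanSpace ℝ (Fin d)) × (Fin m → ℝ)) :=
    {ω | ¬ ∀ r, |ω.2 r| = |a|} with hS₀
  set S₁ : Fin n → Set ((Fin m → EuclideanSpace ℝ (Fin d)) × (Fin m → ℝ)) := fun i =>
    {ω | energy ω.1 (e i) ≤
      κ ^ 2 * ((gaussianReal 0 (κ ^ 2).toNNReal).real (Set.Ici κ) / 2) * m} with hS₁
  set S₂ : Fin n → Set ((Fin m → EuclideanSpace ℝ (Fin d)) × (Fin m → ℝ)) := fun i =>
    {ω | L * √(m : ℝ) ≤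
      ((Finset.univ.filter fun r => |⟪ω.1 r, e i⟫| ≤ ρ / √(m : ℝ)).card : ℝ)} with hS₂
  set S₃ : Fin n → Set ((Fin m → EuclideanSpace ℝ (Fin d)) × (Fin m → ℝ)) := fun i =>
    {ω | U ≤ |output (coeffs ω.2 p) ω.1 (e i)|} with hS₃
  have hsub : {ω | ¬ ∀ i, RegularInit (a * |P|) θ L ρ (coeffs ω.2 p) ω.1 (e i) ∧
      |output (coeffs ω.2 p) ω.1 (e i)| ≤ U} ⊆ S₀ ∪ ⋃ i, (S₁ i ∪ S₂ i ∪ S₃ i) := by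
    intro ω hω
    by_contra hc
    simp only [Set.mem_union, Set.mem_iUnion, not_or, not_exists, hS₀, hS₁, hS₂, hS₃,
      Set.mem_ofPred_eq, not_not, not_le] at hc
    obtain ⟨h0, h1⟩ := hc
    refine hω fun i => ⟨⟨hm, by positivity, hθ, hρ, he i, fun r => ?_, ?_, (h1 i).1.2.le, hρθ⟩,
      (h1 i).2.le⟩
    · rw [coeffs, abs_mul, h0 r, abs_of_pos ha, mul_assoc]
      have := (hp r).trans (mul_le_mul_of_nonneg_right (le_abs_self P) hsm.le)
      gcongr
    · refine Real.le_sqrt_of_sq_le ?_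
      rw [mul_pow, hθq, Real.sq_sqrt (Nat.cast_nonneg m)]
      exact (h1 i).1.1.le
  have b₁ : ∀ i, initLaw d κ a m (S₁ i) ≤ ENNReal.ofReal δ' := fun i =>
    (initLaw_energy_le hκ a hm (he i)).trans (ENNReal.ofReal_le_ofReal hmq)
  have b₂ : ∀ i, initLaw d κ a m (S₂ i) ≤ ENNReal.ofReal δ' := fun i => by
    refine (initLaw_card_inner_le hκ a (he i) (by positivity) (by positivity)).trans
      (ENNReal.ofReal_le_ofReal (le_trans (le_of_eq ?_) hLδ))
    calc m * (ρ / √(m : ℝ) / κ) / (L * √(m : ℝ))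
        = √(m : ℝ) * √(m : ℝ) * (ρ / √(m : ℝ) / κ) / (L * √(m : ℝ)) := by rw [hmm]
      _ = ρ / κ / L := by field_simp
  have b₃ : ∀ i, initLaw d κ a m (S₃ i) ≤ ENNReal.ofReal δ' := fun i =>
    (initLaw_abs_output_ge_le κ a P p hp (e i) hU).trans (ENNReal.ofReal_le_ofReal hUδ)
  calc _ ≤ initLaw d κ a m (S₀ ∪ ⋃ i, (S₁ i ∪ S₂ i ∪ S₃ i)) := measure_mono hsub
    _ ≤ initLaw d κ a m S₀ + ∑ i, initLaw d κ a m (S₁ i ∪ S₂ i ∪ S₃ i) :=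
        (measure_union_le _ _).trans (add_le_add le_rfl (measure_iUnion_fintype_le _ _))
    _ ≤ 0 + ∑ _i : Fin n, 3 * ENNReal.ofReal δ' := by
        refine add_le_add (initLaw_abs_snd_ne d κ a m).le (Finset.sum_le_sum fun i _ => ?_)
        refine ((measure_union_le _ _).trans (add_le_add ((measure_union_le _ _).trans
          (add_le_add (b₁ i) (b₂ i))) (b₃ i))).trans (le_of_eq ?_)
        ring
    _ = n * (3 * ENNReal.ofReal δ') := by simp

theorem mainTheorem4
    (n : ℕ) (Rx C κ a P lam0 δ : ℝ)
    (hκ : 0 < κ) (ha : 0 < a) (hlam0 : 0 < lam0) (hδ : 0 < δ)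
    (T : ℕ → ℕ) (hT : ∃ q : ℕ, (fun m => (T m : ℝ)) =O[atTop] fun m : ℕ => (m : ℝ) ^ q) :
    ∃ K : ℝ, ∃ m₀ : ℕ,
      ∀ (d : ℕ) (x : Fin n → EuclideanSpace ℝ (Fin d)) (y : EuclideanSpace ℝ (Fin n))
        (p : ∀ m : ℕ, Fin m → ℝ) (Hinf : Matrix (Fin n) (Fin n) ℝ)
        (H : ∀ m : ℕ, (Fin m → ℝ) → (Fin m → EuclideanSpace ℝ (Fin d)) →
          Matrix (Fin n) (Fin n) ℝ),
        -- the kernel is the NTK, as a Gram matrix of gradients or in its closed form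
        ((H = fun _ => ntk x) ∨ (H = fun _ => ntkClosed x)) →
        -- bounded data
        (∀ i, ‖x i‖ ≤ Rx) → (∀ i, |y i| ≤ C) →
        -- no single channel dominates
        (∀ m r, |p m r| ≤ P * √(m : ℝ)) →
        -- non-degenerate infinite-width NTK
        IsInfiniteWidthNTK H κ a p Hinf → IsLeast (spectrum ℝ Hinf) lam0 →
        ∀ m ≥ m₀,
          initLaw d κ a m {ω | ¬ (
            specNorm (H m (coeffs ω.2 (p m)) ω.1 - Hinf) ≤ lam0 / 2 →
            ∀ η : ℝ, 0 < η → η ≤ (specNorm (H m (coeffs ω.2 (p m)) ω.1))⁻¹ →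
            ∀ (lam : Fin n → ℝ) (v : OrthonormalBasis (Fin n) ℝ (EuclideanSpace ℝ (Fin n))),
              H m (coeffs ω.2 (p m)) ω.1 = ∑ i, lam i • Matrix.vecMulVec (v i) (v i) →
              ∃ ε : ℕ → ℝ,
                (∀ k,
                  ‖predictions x (coeffs ω.2 (p m))
                      (gdWeights x y (coeffs ω.2 (p m)) η ω.1 k) - y‖ =
                    √(∑ i, (1 - η * lam i) ^ (2 * k) *
                      (⟪v i, predictions x (coeffs ω.2 (p m)) ω.1 - y⟫) ^ 2) + ε k) ∧
                ∀ k ≤ T m, |ε k| ≤ K / √(m : ℝ))}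
            ≤ ENNReal.ofReal δ := by
  set q := (gaussianReal 0 (κ ^ 2).toNNReal).real (Set.Ici κ) with hq
  have hq0 : 0 < q := gaussianReal_Ici_pos hκ
  obtain ⟨δ', hδ'⟩ : ∃ δ', δ' = δ / (3 * (n + 1)) := ⟨_, rfl⟩
  have hδ'0 : 0 < δ' := by rw [hδ']; positivity
  -- the constants of the regular initialization, each depending only on the previous ones
  obtain ⟨A, hA⟩ : ∃ A, A = a * |P| := ⟨_, rfl⟩
  obtain ⟨θ, hθ⟩ : ∃ θ, θ = √(κ ^ 2 * (q / 2)) / 2 := ⟨_, rfl⟩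
  obtain ⟨U, hU⟩ : ∃ U, U = A / √δ' + 1 := ⟨_, rfl⟩
  obtain ⟨D, hD⟩ : ∃ D, D = n * (U + |C|) := ⟨_, rfl⟩
  obtain ⟨M, hM⟩ : ∃ M, M = D + |C| + U := ⟨_, rfl⟩
  obtain ⟨B, hB⟩ : ∃ B, B = (A + M) / θ := ⟨_, rfl⟩
  obtain ⟨ρ, hρ⟩ : ∃ ρ, ρ = n * B * D * (2 / (lam0 / 2)) := ⟨_, rfl⟩
  obtain ⟨L, hL⟩ : ∃ L, L = ρ / κ / δ' + 1 := ⟨_, rfl⟩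
  obtain ⟨s, hs⟩ : ∃ s, s = A * L / θ + A * ρ / θ ^ 2 + (A + M) / θ := ⟨_, rfl⟩
  have hA0 : 0 ≤ A := by rw [hA]; positivity
  have hθ0 : 0 < θ := by rw [hθ]; positivity
  have hU0 : 0 < U := by rw [hU]; positivity
  have hD0 : 0 ≤ D := by rw [hD]; positivity
  have hM0 : 0 ≤ M := by rw [hM]; positivity
  have hB0 : 0 ≤ B := by rw [hB]; positivity
  have hρ0 : 0 ≤ ρ := by rw [hρ]; positivity
  have hL0 : 0 < L := by rw [hL]; positivity
  have hsum0 : 0 ≤ A * L / θ + A * ρ / θ ^ 2 := by positivity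
  have hlim : Tendsto (fun m : ℕ => √(m : ℝ)) atTop atTop :=
    Real.tendsto_sqrt_atTop.comp tendsto_natCast_atTop_atTop
  have hev : ∀ᶠ m : ℕ in atTop, 0 < m ∧ 4 / (m * q ^ 2) ≤ δ' ∧ ρ ≤ θ * √(m : ℝ) ∧
      4 * n ^ 2 * B * s / √(m : ℝ) ≤ lam0 / 2 / 2 := by
    have e1 : Tendsto (fun m : ℕ => 4 / (m * q ^ 2)) atTop (𝓝 0) :=
      tendsto_const_nhds.div_atTop
        (tendsto_natCast_atTop_atTop.atTop_mul_const (by positivity))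
    have e3 : Tendsto (fun m : ℕ => 4 * n ^ 2 * B * s / √(m : ℝ)) atTop (𝓝 0) :=
      tendsto_const_nhds.div_atTop hlim
    filter_upwards [eventually_gt_atTop 0, e1.eventually (ge_mem_nhds hδ'0),
      (hlim.const_mul_atTop hθ0).eventually_ge_atTop ρ,
      e3.eventually (ge_mem_nhds (by positivity : 0 < lam0 / 2 / 2))] with m h0 h1 h2 h3
    exact ⟨h0, h1, h2, h3⟩
  obtain ⟨m₀, hm₀⟩ := eventually_atTop.1 hev
  refine ⟨4 * n ^ 2 * B * s * D * (2 / (lam0 / 2)), m₀, ?_⟩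
  intro d x y p Hinf H hH _ hy hp hlimH hspec m hm
  obtain ⟨hmpos, hmq, hmρ, hmE⟩ := hm₀ m hm
  have hsymm : ∀ m c W i j, H m c W i j = H m c W j i := by
    intro m c W i j
    rcases hH with rfl | rfl
    · simp only [ntk_apply_eq, real_inner_comm (x i), mul_comm (outCoef c W (x i) _)]
    · simp only [ntkClosed_apply_eq, real_inner_comm (x i), mul_comm (closedCoef c W (x i) _)]
  have hinf := mul_norm_sq_le_inner_of_isLeast_spectrum (hlimH.isHermitian hsymm) hspec
  have hlow : ∀ ω : (Fin m → EuclideanSpace ℝ (Fin d)) × (Fin m → ℝ),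
      specNorm (H m (coeffs ω.2 (p m)) ω.1 - Hinf) ≤ lam0 / 2 → ∀ w,
      lam0 / 2 * ‖w‖ ^ 2 ≤
        ⟪w, Matrix.toEuclideanCLM (𝕜 := ℝ) (H m (coeffs ω.2 (p m)) ω.1) w⟫ := fun ω hω w => by
    have := mul_norm_sq_le_inner_of_specNorm_sub_le hinf hω w
    rwa [sub_half] at this
  by_cases hx : ∃ i, x i = 0
  · -- a vanishing input makes a diagonal entry of the kernel vanish, which `hlow` excludes
    obtain ⟨i, hi⟩ := hx
    refine le_trans (le_of_eq ?_) zero_le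
    refine measure_mono_null (fun ω hω => ?_) measure_empty
    refine hω fun hclose => absurd (hlow ω hclose (EuclideanSpace.single i 1)) ?_
    have hii : H m (coeffs ω.2 (p m)) ω.1 i i = 0 := by
      rcases hH with rfl | rfl
      · simp [ntk_apply_eq, hi]
      · simp [ntkClosed_apply_eq, hi]
    rw [Matrix.inner_toEuclideanCLM]
    simp [hii, hlam0]
  push Not at hx
  -- everything is invariant under rescaling the inputs, which may hence be taken of norm one
  set t : Fin n → ℝ := fun i => ‖x i‖⁻¹ with ht
  have htpos : ∀ i, 0 < t i := fun i => inv_pos.2 (norm_pos_iff.2 (hx i))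
  set e : Fin n → EuclideanSpace ℝ (Fin d) := fun i => t i • x i with he
  have hen : ∀ i, ‖e i‖ = 1 := fun i => by
    simp [he, ht, norm_smul, (norm_pos_iff.2 (hx i)).ne']
  have hprob := initLaw_not_regular_le (P := P) (p := p m) (e := e) hκ ha hmpos hθ0 hL0 hU0
    hρ0 (by rw [hθ, mul_div_cancel₀ _ two_ne_zero, Real.sq_sqrt (by positivity)]) hmq
    (by
      rw [div_le_iff₀ (by positivity)]
      have h1 : A ≤ √δ' * U := by
        rw [hU, mul_add, mul_div_cancel₀ _ (Real.sqrt_pos.2 hδ'0).ne']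
        linarith [Real.sqrt_nonneg δ']
      have h2 := pow_le_pow_left₀ hA0 h1 2
      rwa [mul_pow, Real.sq_sqrt hδ'0.le, hA, mul_pow, sq_abs] at h2)
    (by
      rw [div_le_iff₀ hL0, hL, mul_add, mul_div_cancel₀ _ hδ'0.ne']
      linarith)
    hmρ (hp m) hen
  refine (measure_mono fun ω hω => ?_).trans (hprob.trans ?_)
  · refine fun hreg => hω fun hclose η hη hηH lam v hdec => ?_
    set c := coeffs ω.2 (p m) with hc
    have hreg' := fun i => (hreg i).1
    rw [← hA] at hreg'
    have hU' := fun i => (hreg i).2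
    have hDz : ‖predictions e c ω.1 - y‖ ≤ D := by
      rw [hD]
      refine norm_le_of_forall_abs_le fun i => ?_
      exact (abs_sub _ _).trans (add_le_add (hU' i) ((hy i).trans (le_abs_self C)))
    have hUM : ∀ i, |output c ω.1 (e i)| ≤ M := fun i =>
      (hU' i).trans (by rw [hM]; linarith [abs_nonneg C])
    have hAM : A ≤ A + M := by linarith
    have hMA : M / θ ≤ (A + M) / θ := by gcongr; linarith
    have hs' : A * L / θ + A * ρ / θ ^ 2 + M / θ ≤ s := by rw [hs]; gcongr
    have hAs : A / θ ≤ s := by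
      rw [hs]
      have : A / θ ≤ (A + M) / θ := by gcongr
      linarith
    have hker : ∀ i j, |H m c ω.1 i j - leadKernel e c ω.1 i j| ≤ B / √(m : ℝ) * (2 * s) := by
      intro i j
      rcases hH with rfl | rfl
      · change |ntk x c ω.1 i j - _| ≤ _
        rw [← ntk_smul x c ω.1 htpos]
        refine (RegularInit.abs_ntk_sub_leadKernel_le hreg' hUM i j).trans ?_
        rw [hB]
        gcongr
      · change |ntkClosed x c ω.1 i j - _| ≤ _
        rw [← ntkClosed_smul x c ω.1 htpos]
        refine (RegularInit.abs_ntkClosed_sub_leadKernel_le hreg' i j).trans ?_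
        rw [hB]
        gcongr
    obtain ⟨ε, hε⟩ := RegularInit.exists_error hreg' hB.ge hs' hker (half_pos hlam0)
      (hlow ω hclose) hη hηH hDz
      (fun i => by rw [hM]; linarith [(hy i).trans (le_abs_self C)]) hρ.ge hmE hdec
    refine ⟨ε, fun k => ?_, fun k _ => (hε k).2⟩
    have := (hε k).1
    rwa [gdWeights_smul x c ω.1 htpos, predictions_smul x c _ htpos,
      predictions_smul x c _ htpos] at this
  · rw [show (3 : ENNReal) = ENNReal.ofReal 3 by norm_num,
      ← ENNReal.ofReal_natCast, ← ENNReal.ofReal_mul (by norm_num),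
      ← ENNReal.ofReal_mul (by positivity)]
    refine ENNReal.ofReal_le_ofReal ?_
    rw [hδ']
    calc (n : ℝ) * (3 * (δ / (3 * (n + 1)))) = δ * (n / (n + 1)) := by field_simp
      _ ≤ δ * 1 := by
          gcongr
          rw [div_le_one (by positivity)]
          linarith
      _ = δ := mul_one δ
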